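/- Let $d\ge 1$, let $\mathbb B=\{x\in\mathbb R^d:|x|\le 1\}$ be the closed Euclidean unit ball, let $|\cdot|$ denote Lebesgue measure of sets, $E\Delta\mathbb B$ the symmetric difference, $\|h\|_{L^p(S)}$ the $L^p$ norm over a set $S$, $\|\cdot\|_q$ the norm of $L^q(\mathbb R^d)$, and $\widehat F(\xi)=\int_{\mathbb R^d}e^{-2\pi i x\cdot\xi}F(x)\,dx$. Let $\overline q\ge 4$ be an even integer. There exist $M,N\in(0,\infty)$, $\delta_0>0$ and $\rho>0$, all depending only on $\overline q$ and $d$, such that for every real $q\in(3,\infty)$ with $|q-\overline q|\le\rho$ there is a constant $c_{q,d}>0$, depending only on $q$ and $d$, with the following property. Let $E\subset\mathbb R^d$ be a Lebesgue measurable set with $|E|\le|\mathbb B|$, and let $f,g:\mathbb R^d\to\mathbb R$ be Lebesgue measurable functions with $0\le f\le 1$ almost everywhere and $g\in L^2(E)$. Suppose that $$\|f-1\|_{L^1(\mathbb B)}\le\delta_0,\qquad \|g\|_{L^2(E)}\le\delta_0,\qquad |E\Delta\mathbb B|\le\delta_0,$$ and $$\|f-1\|_{L^1(E)}^{1/2}\ge\max\bigl(MN\,|E\Delta\mathbb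 B|,\ N\|g\|_{L^2(E)}\bigr).$$ Then $\widehat{fe^{ig}1_E}$ and $\widehat{1_{\mathbb B}}$ belong to $L^q(\mathbb R^d)$, and $$\|\widehat{fe^{ig}1_E}\|_q^q\le\|\widehat{1_{\mathbb B}}\|_q^q-c_{q,d}\,\|f-1\|_{L^1(E)}.$$ -/

import Mathlib

open MeasureTheory
open scoped FourierTransform ENNReal

noncomputable section

/-- The closed unit ball of `ℝ^d` with its Euclidean norm. -/
def unitBall (d : ℕ) : Set (EuclideanSpace ℝ (Fin d)) := Metric.closedBall 0 1

/-- The indicator function of the unit ball, as a complex-valued function. -/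
def ballIndicator (d : ℕ) : EuclideanSpace ℝ (Fin d) → ℂ :=
  (unitBall d).indicator fun _ => 1

/-- The function `f e^{ig} 1_E`. -/
def modulatedIndicator {d : ℕ} (E : Set (EuclideanSpace ℝ (Fin d)))
    (f g : EuclideanSpace ℝ (Fin d) → ℝ) : EuclideanSpace ℝ (Fin d) → ℂ :=
  E.indicator fun x => (f x : ℂ) * Complex.exp (Complex.I * (g x : ℂ))

/-- The real number `‖h‖_{L^p(S)}` (meaningful when `h ∈ L^p(S)`). -/
def lpNormOn {d : ℕ} (p : ℝ≥0∞) (S : Set (EuclideanSpace ℝ (Fin d)))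
    (h : EuclideanSpace ℝ (Fin d) → ℝ) : ℝ :=
  (eLpNorm h p (volume.restrict S)).toReal

/-- The real number `‖F̂‖_q^q`, where `F̂(ξ) = ∫ e^{-2πi x·ξ} F(x) dx`
(meaningful when `F̂ ∈ L^q`). -/
def fourierLqPow {d : ℕ} (q : ℝ) (F : EuclideanSpace ℝ (Fin d) → ℂ) : ℝ :=
  (eLpNorm (𝓕 F) (ENNReal.ofReal q) volume).toReal ^ q

end

/-! Let φ be the Fourier transform of the indicator of the ball 𝔹; it is real and radial. Put h = f
e^{ig} 1_E - 1_𝔹. At 1_𝔹 the functional ‖F̂‖_q^q has first variation q ∫ K Re h, where K is the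
Fourier transform of |φ|^{q-2} φ. The remainder is bounded above by a multiple of ‖h‖₁² + ‖h‖₁^{q-2}
‖h‖₂² (`exists_fourierLqPow_add_le`).

Suppose K ≥ κ > 0 on 𝔹 and K ≤ κ off it. Since |E| ≤ |𝔹|, comparing K with the constant κ (a bathtub
argument, `kernel_mul_re_modulatedIndicator_sub_le`) gives ∫ K Re h ≤ -κ ‖f-1‖_{L¹(E)} + O(‖g‖₂²).
The hypotheses make ‖h‖₁ a small multiple of ‖f-1‖_{L¹(E)}^{1/2}, so the remainder and the g term
are both absorbed (`first_order_dominates`).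

The level κ is found first at the even integer q̄, where |φ|^{q̄-2} φ = φ^{q̄-1} and K is a
(q̄-1)-fold convolution power of 1_𝔹. A reflection argument shows that it is radially nonincreasing
and falls at a linear rate across the unit sphere (`ballAverage_slope`). For q near q̄ the kernel
changes little in sup norm and in Lipschitz constant, so the crossing at the sphere survives
(`exists_kernel_level`). The required integrability of powers of φ comes from
`integrable_sqrt_norm_mul_ballFourier_sq`, which uses only the L² modulus of continuity of 1_𝔹 under
translation. -/

/-! ### The Fourier integral on L¹ ∩ L² and Plancherel's identity. -/

section FourierBasics

open scoped ContDiff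

variable {V : Type*} [NormedAddCommGroup V] [InnerProductSpace ℝ V] [MeasurableSpace V]
  [BorelSpace V] [FiniteDimensional ℝ V]

theorem continuous_fourier {f : V → ℂ} (hf : Integrable f) : Continuous (𝓕 f) :=
  VectorFourier.fourierIntegral_continuous Real.continuous_fourierChar
    (by exact continuous_inner) hf

theorem norm_fourier_le (f : V → ℂ) (ξ : V) : ‖𝓕 f ξ‖ ≤ ∫ x, ‖f x‖ :=
  VectorFourier.norm_fourierIntegral_le_integral_norm _ _ _ _ _

theorem fourier_add_apply {f g : V → ℂ} (hf : Integrable f) (hg : Integrable g) (ξ : V) :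
    𝓕 (f + g) ξ = 𝓕 f ξ + 𝓕 g ξ :=
  congrFun (VectorFourier.fourierIntegral_add Real.continuous_fourierChar
    (by exact continuous_inner) hf hg) ξ

theorem fourier_sub_apply {f g : V → ℂ} (hf : Integrable f) (hg : Integrable g) (ξ : V) :
    𝓕 (f - g) ξ = 𝓕 f ξ - 𝓕 g ξ := by
  have h := fourier_add_apply (hf.sub hg) hg ξ
  rw [sub_add_cancel] at h
  rw [h, add_sub_cancel_right]

theorem integral_fourier_mul_eq {f g : V → ℂ} (hf : Integrable f) (hg : Integrable g) :
    ∫ ξ, 𝓕 f ξ * g ξ = ∫ x, f x * 𝓕 g x := by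
  have := VectorFourier.integral_fourierIntegral_smul_eq_flip (μ := volume) (ν := volume)
    (L := innerₗ V) Real.continuous_fourierChar (by exact continuous_inner) hf hg
  rw [flip_innerₗ] at this
  exact this

/-- The `L²` Fourier transform agrees with the Fourier integral on `L¹ ∩ L²`. -/
theorem fourier_toLp_ae_eq {f : V → ℂ} (hf : Integrable f) (hf2 : MemLp f 2) :
    (𝓕 (hf2.toLp f) : Lp ℂ 2 (volume : Measure V)) =ᵐ[volume] 𝓕 f := by
  -- Test functions suffice. The L² transform agrees with the distributional one, and the
  -- multiplication formula moves the Fourier integral of `f` onto the test function in the same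
  -- way.
  refine ae_eq_of_integral_contDiff_smul_eq
    ((Lp.memLp (𝓕 (hf2.toLp f))).locallyIntegrable (by norm_num))
    (continuous_fourier hf).locallyIntegrable fun g hg hgs => ?_
  have hgs' : HasCompactSupport (fun x => (g x : ℂ)) :=
    hgs.comp_left (g := ((↑) : ℝ → ℂ)) rfl
  have hg' : ContDiff ℝ ∞ (fun x => (g x : ℂ)) := Complex.ofRealCLM.contDiff.comp hg
  let φ : SchwartzMap V ℂ := hgs'.toSchwartzMap hg'
  have hφ : ∀ x, φ x = (g x : ℂ) := fun x => rfl
  have h1 := congrArg (fun T => T φ) (Lp.fourier_toTemperedDistribution_eq (E := V) (F := ℂ) (hf2.toLp f))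
  simp only [TemperedDistribution.fourier_apply, Lp.toTemperedDistribution_apply] at h1
  have h2 : ∫ x, (𝓕 φ) x • (hf2.toLp f) x = ∫ x, f x * 𝓕 (φ : V → ℂ) x := by
    refine integral_congr_ae ?_
    filter_upwards [hf2.coeFn_toLp] with x hx
    rw [hx, smul_eq_mul, mul_comm, SchwartzMap.fourier_coe]
  rw [h2, ← integral_fourier_mul_eq hf (φ.integrable (μ := volume))] at h1
  calc ∫ x, g x • (𝓕 (hf2.toLp f) : Lp ℂ 2 (volume : Measure V)) x
      = ∫ x, φ x • (𝓕 (hf2.toLp f) : Lp ℂ 2 (volume : Measure V)) x := by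
        simp [hφ]
    _ = ∫ ξ, 𝓕 f ξ * φ ξ := h1.symm
    _ = ∫ x, g x • 𝓕 f x := by simp [hφ, mul_comm]

theorem eLpNorm_fourier_eq {f : V → ℂ} (hf : Integrable f) (hf2 : MemLp f 2) :
    eLpNorm (𝓕 f) 2 volume = eLpNorm f 2 volume := by
  rw [← eLpNorm_congr_ae (fourier_toLp_ae_eq hf hf2), ← eLpNorm_congr_ae hf2.coeFn_toLp,
    ← Lp.enorm_def, ← Lp.enorm_def, ← ofReal_norm, ← ofReal_norm, Lp.norm_fourier_eq]

theorem memLp_fourier_two {f : V → ℂ} (hf : Integrable f) (hf2 : MemLp f 2) :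
    MemLp (𝓕 f) 2 volume :=
  ⟨(continuous_fourier hf).aestronglyMeasurable, by
    rw [eLpNorm_fourier_eq hf hf2]; exact hf2.2⟩

theorem integral_norm_fourier_sq {f : V → ℂ} (hf : Integrable f) (hf2 : MemLp f 2) :
    ∫ ξ, ‖𝓕 f ξ‖ ^ 2 = ∫ x, ‖f x‖ ^ 2 := by
  have h1 := (memLp_fourier_two hf hf2).eLpNorm_eq_integral_rpow_norm (by norm_num) (by norm_num)
  have h2 := hf2.eLpNorm_eq_integral_rpow_norm (by norm_num) (by norm_num)
  rw [eLpNorm_fourier_eq hf hf2, h2] at h1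
  simp only [ENNReal.toReal_ofNat, Real.rpow_two] at h1
  have p1 : 0 ≤ ∫ ξ, ‖𝓕 f ξ‖ ^ 2 := by positivity
  have p2 : 0 ≤ ∫ x, ‖f x‖ ^ 2 := by positivity
  rw [ENNReal.ofReal_eq_ofReal_iff (by positivity) (by positivity)] at h1
  exact ((Real.rpow_left_inj p2 p1 (by norm_num)).1 h1).symm

end FourierBasics

/-! ### A second-order pointwise inequality for powers. -/

section PointwiseInequality

/-- A second-order upper bound for `|a + b| ^ p`, uniform over bounded ranges of `p ≥ 2`. -/
theorem exists_norm_add_rpow_le (P : ℝ) :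
    ∃ C : ℝ, 0 < C ∧ ∀ p : ℝ, 2 ≤ p → p ≤ P → ∀ (a : ℝ) (b : ℂ),
      ‖(a : ℂ) + b‖ ^ p ≤ |a| ^ p + p * (|a| ^ (p - 2) * a * b.re)
        + C * (|a| ^ (p - 2) * ‖b‖ ^ 2 + ‖b‖ ^ p) := by
  by_cases hP : 2 ≤ P
  swap
  · exact ⟨1, one_pos, fun p h1 h2 => absurd (h1.trans h2) hP⟩
  -- The threshold between the two regimes. If |a| ≤ L‖b‖, every term is O(‖b‖^p). If |a| > L‖b‖,
  -- the choice L = 2P forces P‖b‖/|a| ≤ 1/2, which keeps the exponent `m * Y` below 1 in absolute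
  -- value.
  set L : ℝ := 2 * P with hL
  have hL1 : 1 ≤ L := by linarith
  refine ⟨(1 + L) ^ P + P * L ^ P + (P + 3 * P ^ 2), by positivity, fun p hp2 hpP a b => ?_⟩
  have hp0 : 0 < p := by linarith
  have hb0 : 0 ≤ ‖b‖ := norm_nonneg b
  have hre : |b.re| ≤ ‖b‖ := Complex.abs_re_le_norm b
  have hAp : 0 ≤ |a| ^ (p - 2) := by positivity
  have hBp : 0 ≤ ‖b‖ ^ p := by positivity
  rcases le_or_gt |a| (L * ‖b‖) with h | h
  · have e1 : ‖(a : ℂ) + b‖ ^ p ≤ (1 + L) ^ P * ‖b‖ ^ p := by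
      calc ‖(a : ℂ) + b‖ ^ p ≤ ((1 + L) * ‖b‖) ^ p := by
            gcongr
            refine (norm_add_le _ _).trans ?_
            rw [Complex.norm_real, Real.norm_eq_abs]
            linarith
        _ = (1 + L) ^ p * ‖b‖ ^ p := Real.mul_rpow (by positivity) hb0
        _ ≤ _ := by gcongr; linarith
    have e2 : -(p * (|a| ^ (p - 2) * a * b.re)) ≤ P * L ^ P * ‖b‖ ^ p := by
      rcases eq_or_ne a 0 with rfl | ha
      · simp; positivity
      have hb : 0 < ‖b‖ := by
        by_contra hb
        have : ‖b‖ = 0 := le_antisymm (not_lt.1 hb) hb0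
        rw [this, mul_zero] at h
        exact ha (abs_eq_zero.1 (le_antisymm h (abs_nonneg _)))
      calc -(p * (|a| ^ (p - 2) * a * b.re)) ≤ |p * (|a| ^ (p - 2) * a * b.re)| := neg_le_abs _
        _ = p * (|a| ^ (p - 2) * |a| * |b.re|) := by
            rw [abs_mul, abs_mul, abs_mul, abs_of_pos hp0, abs_of_nonneg hAp]
        _ ≤ P * ((L * ‖b‖) ^ (p - 2) * (L * ‖b‖) * ‖b‖) := by gcongr
        _ = P * (L ^ (p - 2) * L * (‖b‖ ^ (p - 2) * ‖b‖ * ‖b‖)) := by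
            rw [Real.mul_rpow (by positivity) hb0]; ring
        _ = P * (L ^ (p - 1) * ‖b‖ ^ p) := by
            congr 2
            · rw [← Real.rpow_add_one (by positivity)]; ring_nf
            · rw [← Real.rpow_add_one hb.ne', ← Real.rpow_add_one hb.ne']; ring_nf
        _ ≤ P * (L ^ P * ‖b‖ ^ p) := by gcongr; linarith
        _ = _ := by ring
    have e3 : 0 ≤ |a| ^ p := by positivity
    have e4 : 0 ≤ (1 + L) ^ P * (|a| ^ (p - 2) * ‖b‖ ^ 2) := by positivity
    have e5 : 0 ≤ P * L ^ P * (|a| ^ (p - 2) * ‖b‖ ^ 2) := by positivity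
    have e6 : 0 ≤ (P + 3 * P ^ 2) * (|a| ^ (p - 2) * ‖b‖ ^ 2 + ‖b‖ ^ p) := by positivity
    nlinarith
  · have ha : 0 < |a| := lt_of_le_of_lt (by positivity) h
    have ha' : a ≠ 0 := abs_pos.1 ha
    set m : ℝ := p / 2 with hm
    -- Then |a + b|^p = |a|^p (1 + Y)^{p/2}, and the expansion follows from 1 + Y ≤ e^Y and e^t ≤ 1
    -- + t + t² for |t| ≤ 1.
    set Y : ℝ := 2 * (b.re / a) + (‖b‖ / a) ^ 2 with hY
    have hsq : ‖(a : ℂ) + b‖ ^ 2 = a ^ 2 * (1 + Y) := by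
      rw [← Complex.normSq_eq_norm_sq, hY, div_pow, ← Complex.normSq_eq_norm_sq,
        Complex.normSq_apply, Complex.normSq_apply]
      simp only [Complex.add_re, Complex.add_im, Complex.ofReal_re, Complex.ofReal_im]
      field_simp
      ring
    have hz : ‖b‖ / |a| ≤ 1 / L := by
      rw [div_le_div_iff₀ ha (by positivity)]; linarith
    set z : ℝ := ‖b‖ / |a| with hzdef
    have hz0 : 0 ≤ z := by positivity
    have hz1 : z ≤ 1 / 2 := hz.trans (by rw [div_le_div_iff₀ (by positivity) (by norm_num)]; linarith)
    have hbz : (‖b‖ / a) ^ 2 = z ^ 2 := by rw [hzdef, div_pow, div_pow, sq_abs]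
    have hbr : |b.re / a| ≤ z := by rw [abs_div, hzdef]; gcongr
    have hYz : |Y| ≤ 5 / 2 * z := by
      rw [hY, hbz]
      refine (abs_add_le _ _).trans ?_
      rw [abs_mul, abs_of_nonneg (sq_nonneg z), abs_two]
      nlinarith
    have hmP : m ≤ P / 2 := by rw [hm]; linarith
    have hm0 : 0 ≤ m := by positivity
    have hPL : P * z ≤ 1 / 2 := by
      calc P * z ≤ P * (1 / L) := by gcongr
        _ = 1 / 2 := by rw [hL]; field_simp
    have hmY : |m * Y| ≤ 5 / 4 * (P * z) := by
      rw [abs_mul, abs_of_nonneg hm0]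
      calc m * |Y| ≤ P / 2 * (5 / 2 * z) := by gcongr
        _ = _ := by ring
    have hY1 : 0 ≤ 1 + Y := by
      have : 0 ≤ a ^ 2 * (1 + Y) := hsq ▸ by positivity
      exact nonneg_of_mul_nonneg_right this (by positivity)
    have hexp : (1 + Y) ^ m ≤ 1 + m * Y + (m * Y) ^ 2 := by
      calc (1 + Y) ^ m ≤ (Real.exp Y) ^ m := by
            gcongr; linarith [Real.add_one_le_exp Y]
        _ = Real.exp (m * Y) := by rw [← Real.exp_mul, mul_comm]
        _ ≤ _ := by
            have := (abs_le.1 (Real.abs_exp_sub_one_sub_id_le (x := m * Y) (by linarith))).2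
            linarith
    have hmY2 : (m * Y) ^ 2 ≤ 2 * P ^ 2 * z ^ 2 := by
      rw [← sq_abs (m * Y)]
      calc |m * Y| ^ 2 ≤ (5 / 4 * (P * z)) ^ 2 := by gcongr
        _ ≤ _ := by nlinarith [sq_nonneg (P * z)]
    have hap : |a| ^ p = |a| ^ (p - 2) * a ^ 2 := by
      rw [← sq_abs a, ← Real.rpow_natCast |a| 2, ← Real.rpow_add ha]; norm_num
    have hlhs : ‖(a : ℂ) + b‖ ^ p = |a| ^ p * (1 + Y) ^ m := by
      have e1 : ‖(a : ℂ) + b‖ ^ p = (‖(a : ℂ) + b‖ ^ 2) ^ m := by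
        rw [← Real.rpow_natCast, ← Real.rpow_mul (norm_nonneg _), hm]; congr 1; push_cast; ring
      have e2 : |a| ^ p = (a ^ 2) ^ m := by
        rw [← sq_abs, ← Real.rpow_natCast, ← Real.rpow_mul (abs_nonneg _), hm]
        congr 1; push_cast; ring
      rw [e1, e2, hsq, Real.mul_rpow (by positivity) hY1]
    have hpz : p / 2 * z ^ 2 ≤ P * z ^ 2 := by gcongr; linarith
    have hfin : (1 + Y) ^ m ≤ 1 + p * (b.re / a) + (P + 3 * P ^ 2) * z ^ 2 := by
      have : m * Y = p * (b.re / a) + p / 2 * z ^ 2 := by rw [hY, hbz, hm]; ring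
      nlinarith [sq_nonneg (P * z)]
    have e4 : 0 ≤ ((1 + L) ^ P + P * L ^ P) * (|a| ^ (p - 2) * ‖b‖ ^ 2 + ‖b‖ ^ p) := by
      positivity
    have e5 : 0 ≤ (P + 3 * P ^ 2) * ‖b‖ ^ p := by positivity
    calc ‖(a : ℂ) + b‖ ^ p ≤ |a| ^ p * (1 + p * (b.re / a) + (P + 3 * P ^ 2) * z ^ 2) := by
          rw [hlhs]; gcongr
      _ = |a| ^ p + p * (|a| ^ (p - 2) * a * b.re)
          + (P + 3 * P ^ 2) * (|a| ^ (p - 2) * ‖b‖ ^ 2) := by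
          rw [← hbz, hap]; field_simp
      _ ≤ _ := by linarith

end PointwiseInequality

/-! ### The Fourier transform of the ball: symmetry, translates and pointwise decay. -/

section BallFourier

variable {d : ℕ}

/-- The (real-valued) Fourier transform of the indicator function of the unit ball. -/
noncomputable def ballFourier (d : ℕ) (ξ : EuclideanSpace ℝ (Fin d)) : ℝ :=
  (𝓕 (ballIndicator d) ξ).re

theorem measurableSet_unitBall : MeasurableSet (unitBall d) := Metric.isClosed_closedBall.measurableSet

theorem volume_unitBall_lt_top : volume (unitBall d) < ∞ := measure_closedBall_lt_top

theorem memLp_ballIndicator (p : ℝ≥0∞) : MemLp (ballIndicator d) p volume :=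
  memLp_indicator_const p measurableSet_unitBall 1 (Or.inr volume_unitBall_lt_top.ne)

theorem integrable_ballIndicator : Integrable (ballIndicator d) :=
  memLp_one_iff_integrable.1 (memLp_ballIndicator 1)

theorem ballIndicator_comp_isometry
    (A : EuclideanSpace ℝ (Fin d) ≃ₗᵢ[ℝ] EuclideanSpace ℝ (Fin d)) :
    ballIndicator d ∘ A = ballIndicator d := by
  ext x
  by_cases hx : ‖x‖ ≤ 1 <;> simp [ballIndicator, unitBall, Set.indicator, hx]

theorem fourier_ballIndicator_isometry
    (A : EuclideanSpace ℝ (Fin d) ≃ₗᵢ[ℝ] EuclideanSpace ℝ (Fin d)) (ξ) :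
    𝓕 (ballIndicator d) (A ξ) = 𝓕 (ballIndicator d) ξ := by
  rw [← Real.fourier_comp_linearIsometry, ballIndicator_comp_isometry]

theorem conj_fourier_apply {V : Type*} [NormedAddCommGroup V] [InnerProductSpace ℝ V]
    [MeasurableSpace V] [BorelSpace V] [FiniteDimensional ℝ V] (f : V → ℂ) (ξ : V) :
    (starRingEnd ℂ) (𝓕 f ξ) = 𝓕 (fun x => (starRingEnd ℂ) (f x)) (-ξ) := by
  rw [Real.fourier_eq, Real.fourier_eq, ← integral_conj]
  congr 1
  ext x
  simp [Circle.smul_def, ← Circle.coe_inv_eq_conj, ← AddChar.map_neg_eq_inv]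

theorem ofReal_ballFourier (ξ : EuclideanSpace ℝ (Fin d)) :
    (ballFourier d ξ : ℂ) = 𝓕 (ballIndicator d) ξ := by
  refine Complex.conj_eq_iff_re.1 ?_
  rw [conj_fourier_apply]
  have : (fun x => (starRingEnd ℂ) (ballIndicator d x)) = ballIndicator d := by
    ext x
    by_cases hx : x ∈ unitBall d <;> simp [ballIndicator, hx]
  rw [this]
  exact fourier_ballIndicator_isometry (LinearIsometryEquiv.neg ℝ) ξ

theorem ballFourier_isometry
    (A : EuclideanSpace ℝ (Fin d) ≃ₗᵢ[ℝ] EuclideanSpace ℝ (Fin d)) (ξ) :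
    ballFourier d (A ξ) = ballFourier d ξ := by
  rw [ballFourier, fourier_ballIndicator_isometry, ballFourier]

theorem norm_fourier_ballIndicator (ξ : EuclideanSpace ℝ (Fin d)) :
    ‖𝓕 (ballIndicator d) ξ‖ = |ballFourier d ξ| := by
  rw [← ofReal_ballFourier, Complex.norm_real, Real.norm_eq_abs]

theorem continuous_ballFourier : Continuous (ballFourier d) :=
  Complex.continuous_re.comp (continuous_fourier integrable_ballIndicator)

theorem abs_ballFourier_le (ξ : EuclideanSpace ℝ (Fin d)) :
    |ballFourier d ξ| ≤ volume.real (unitBall d) := by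
  rw [← norm_fourier_ballIndicator]
  refine (norm_fourier_le _ ξ).trans (le_of_eq ?_)
  have : (fun x => ‖ballIndicator d x‖) = (unitBall d).indicator (fun _ => (1 : ℝ)) := by
    ext x
    by_cases hx : x ∈ unitBall d <;> simp [ballIndicator, hx]
  rw [this]
  exact integral_indicator_one measurableSet_unitBall

theorem volume_real_annulus_le {t : ℝ} (ht : 0 ≤ t) (ht1 : t ≤ 1) :
    volume.real (Metric.closedBall (0 : EuclideanSpace ℝ (Fin d)) (1 + t)
        \ Metric.closedBall 0 (1 - t))
      ≤ (d + 3 ^ d) * volume.real (unitBall d) * t := by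
  have h3 : ∀ n : ℕ, (1 + t) ^ n ≤ 1 + 3 ^ n * t := by
    intro n
    induction n with
    | zero => simp; exact ht
    | succ n ih =>
      rw [pow_succ, pow_succ]
      have : (1 : ℝ) ≤ 3 ^ n := one_le_pow₀ (by norm_num)
      nlinarith [mul_le_mul_of_nonneg_right ih (by linarith : 0 ≤ 1 + t),
        mul_nonneg (by positivity : (0 : ℝ) ≤ 3 ^ n * t) (by linarith : 0 ≤ 1 - t)]
  have h2 : 1 - d * t ≤ (1 - t) ^ d := by
    have := one_add_mul_le_pow (a := -t) (by linarith) d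
    rw [sub_eq_add_neg 1 t]
    linarith
  have hv : 0 ≤ volume.real (unitBall d) := measureReal_nonneg
  rw [measureReal_sdiff (Metric.closedBall_subset_closedBall (by linarith))
    Metric.isClosed_closedBall.measurableSet measure_closedBall_lt_top.ne,
    Measure.addHaar_real_closedBall' _ _ (by linarith : 0 ≤ 1 + t),
    Measure.addHaar_real_closedBall' _ _ (by linarith : 0 ≤ 1 - t), finrank_euclideanSpace_fin]
  change _ * volume.real (unitBall d) - _ * volume.real (unitBall d) ≤ _
  nlinarith [h3 d]

/-- The difference of a translate of the ball's indicator function and the indicator itself. -/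
noncomputable def ballShift (d : ℕ) (h : EuclideanSpace ℝ (Fin d)) :
    EuclideanSpace ℝ (Fin d) → ℂ :=
  (fun x => ballIndicator d (x + h)) - ballIndicator d

theorem norm_ballShift_le (h x : EuclideanSpace ℝ (Fin d)) :
    ‖ballShift d h x‖ ≤ (Metric.closedBall (0 : EuclideanSpace ℝ (Fin d)) (1 + ‖h‖)
        \ Metric.closedBall 0 (1 - ‖h‖)).indicator (fun _ => (1 : ℝ)) x := by
  have h1 : ‖x‖ ≤ ‖x + h‖ + ‖h‖ := by simpa using norm_sub_le (x + h) h
  have h2 : ‖x + h‖ ≤ ‖x‖ + ‖h‖ := norm_add_le x h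
  by_cases ha : ‖x + h‖ ≤ 1 <;> by_cases hb : ‖x‖ ≤ 1
  · simp [ballShift, ballIndicator, unitBall, Set.indicator, ha, hb]
    split_ifs <;> norm_num
  · have h3 : ‖x‖ ≤ 1 + ‖h‖ := by linarith
    have h4 : 1 - ‖h‖ < ‖x‖ := by linarith [norm_nonneg h]
    simp [ballShift, ballIndicator, unitBall, Set.indicator, ha, hb, h3, h4]
  · have h3 : ‖x‖ ≤ 1 + ‖h‖ := by linarith [norm_nonneg h]
    have h4 : 1 - ‖h‖ < ‖x‖ := by linarith
    simp [ballShift, ballIndicator, unitBall, Set.indicator, ha, hb, h3, h4]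
  · simp [ballShift, ballIndicator, unitBall, Set.indicator, ha, hb]
    split_ifs <;> norm_num

theorem memLp_ballShift (p : ℝ≥0∞) (h : EuclideanSpace ℝ (Fin d)) :
    MemLp (ballShift d h) p volume :=
  ((memLp_ballIndicator p).comp_measurePreserving (measurePreserving_add_right volume h)).sub
    (memLp_ballIndicator p)

theorem fourier_ballShift (h ξ : EuclideanSpace ℝ (Fin d)) :
    𝓕 (ballShift d h) ξ = ((Real.fourierChar (inner ℝ h ξ) : ℂ) - 1) * ballFourier d ξ := by
  have h1 : Integrable (fun x => ballIndicator d (x + h)) :=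
    integrable_ballIndicator.comp_add_right h
  rw [ballShift, fourier_sub_apply h1 integrable_ballIndicator, ofReal_ballFourier, sub_mul,
    one_mul]
  congr 1
  exact congrFun (VectorFourier.fourierIntegral_comp_add_right Real.fourierChar volume
    (innerₗ (EuclideanSpace ℝ (Fin d))) (ballIndicator d) h) ξ

/-- The difference of the two indicators is at most 1 and lives in an annulus of thickness 2‖h‖. The
L² bound of order ‖h‖^{1/2} is the only smoothness of 1_𝔹 used later. -/
theorem exists_integral_norm_ballShift_le (d : ℕ) :
    ∃ C : ℝ, 0 < C ∧ ∀ h : EuclideanSpace ℝ (Fin d), ‖h‖ ≤ 1 →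
      ∫ x, ‖ballShift d h x‖ ≤ C * ‖h‖ ∧ ∫ x, ‖ballShift d h x‖ ^ 2 ≤ C * ‖h‖ := by
  have hv : 0 ≤ volume.real (unitBall d) := measureReal_nonneg
  refine ⟨(d + 3 ^ d) * volume.real (unitBall d) + 1, by positivity, fun h hh => ?_⟩
  set A := Metric.closedBall (0 : EuclideanSpace ℝ (Fin d)) (1 + ‖h‖)
        \ Metric.closedBall 0 (1 - ‖h‖)
  have hA : MeasurableSet A :=
    Metric.isClosed_closedBall.measurableSet.diff Metric.isClosed_closedBall.measurableSet
  have hAi : Integrable (A.indicator fun _ => (1 : ℝ)) :=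
    (integrable_indicator_iff hA).2 (integrableOn_const
      ((measure_mono Set.sdiff_subset).trans_lt measure_closedBall_lt_top).ne)
  have hI : ∫ x, A.indicator (fun _ => (1 : ℝ)) x
      ≤ ((d + 3 ^ d) * volume.real (unitBall d) + 1) * ‖h‖ := by
    have e : ∫ x, A.indicator (fun _ => (1 : ℝ)) x = volume.real A := integral_indicator_one hA
    rw [e]
    refine (volume_real_annulus_le (norm_nonneg h) hh).trans ?_
    gcongr
    linarith
  constructor
  · exact (integral_mono_of_nonneg (ae_of_all _ fun x => norm_nonneg _) hAi
      (ae_of_all _ fun x => norm_ballShift_le h x)).trans hI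
  · refine (integral_mono_of_nonneg (ae_of_all _ fun x => by positivity) hAi
      (ae_of_all _ fun x => ?_)).trans hI
    have h1 := norm_ballShift_le h x
    have h2 : A.indicator (fun _ => (1 : ℝ)) x ≤ 1 :=
      Set.indicator_le_self' (fun _ _ => zero_le_one) x |>.trans le_rfl
    have h3 := norm_nonneg (ballShift d h x)
    change ‖ballShift d h x‖ ^ 2 ≤ A.indicator (fun _ => (1 : ℝ)) x
    nlinarith

theorem exists_norm_mul_abs_ballFourier_le (d : ℕ) :
    ∃ C : ℝ, 0 < C ∧ ∀ ξ : EuclideanSpace ℝ (Fin d), ‖ξ‖ * |ballFourier d ξ| ≤ C := by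
  obtain ⟨C, hC, hC'⟩ := exists_integral_norm_ballShift_le d
  have hv : 0 ≤ volume.real (unitBall d) := measureReal_nonneg
  refine ⟨C + volume.real (unitBall d), by positivity, fun ξ => ?_⟩
  rcases le_or_gt ‖ξ‖ 1 with h1 | h1
  · calc ‖ξ‖ * |ballFourier d ξ| ≤ 1 * volume.real (unitBall d) := by
          gcongr; exact abs_ballFourier_le ξ
      _ ≤ _ := by linarith
  · have h0 : 0 < ‖ξ‖ := by linarith
    -- The shift is parallel to ξ with ⟨h, ξ⟩ = 1/2, so the multiplier e^{2πi⟨h,ξ⟩} - 1 equals -2.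
    -- The L¹ bound on the shift then controls φ(ξ) by a multiple of ‖h‖ = 1/(2‖ξ‖).
    set h := (1 / (2 * ‖ξ‖ ^ 2)) • ξ
    have hh : ‖h‖ = 1 / (2 * ‖ξ‖) := by
      rw [norm_smul, Real.norm_of_nonneg (by positivity)]
      field_simp
    have hin : inner ℝ h ξ = 1 / 2 := by
      rw [real_inner_smul_left, real_inner_self_eq_norm_sq]
      field_simp
    have h2 := norm_fourier_le (ballShift d h) ξ
    have hchar : (Real.fourierChar (1 / 2 : ℝ) : ℂ) = -1 := by
      rw [Real.fourierChar_apply]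
      have : ((2 * Real.pi * (1 / 2) : ℝ) : ℂ) = Real.pi := by push_cast; ring
      rw [this, Complex.exp_pi_mul_I]
    rw [fourier_ballShift, hin, hchar, norm_mul, Complex.norm_real, Real.norm_eq_abs] at h2
    have h3 : ‖(-1 - 1 : ℂ)‖ = 2 := by norm_num
    rw [h3] at h2
    have h4 := (hC' h (by rw [hh, div_le_one (by positivity)]; linarith)).1
    rw [hh] at h4
    have h5 : 2 * |ballFourier d ξ| ≤ C * (1 / (2 * ‖ξ‖)) := h2.trans h4
    have h6 : 2 * |ballFourier d ξ| * ‖ξ‖ ≤ C * (1 / (2 * ‖ξ‖)) * ‖ξ‖ := by gcongr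
    have h7 : C * (1 / (2 * ‖ξ‖)) * ‖ξ‖ = C / 2 := by field_simp
    nlinarith

end BallFourier

/-! ### Integrability of weighted powers of the ball's Fourier transform. -/

section BallFourierIntegrability

variable {d : ℕ}

theorem lintegral_fourierChar_sub_one_le (d : ℕ) :
    ∃ C : ℝ, 0 < C ∧ ∀ h : EuclideanSpace ℝ (Fin d), ‖h‖ ≤ 1 →
      ∫⁻ ξ, ENNReal.ofReal (‖(Real.fourierChar (inner ℝ h ξ) : ℂ) - 1‖ ^ 2
        * ballFourier d ξ ^ 2) ≤ ENNReal.ofReal (C * ‖h‖) := by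
  obtain ⟨C, hC, hC'⟩ := exists_integral_norm_ballShift_le d
  refine ⟨C, hC, fun h hh => ?_⟩
  have h1 : Integrable (ballShift d h) := memLp_one_iff_integrable.1 (memLp_ballShift 1 h)
  have h2 := memLp_ballShift 2 h
  have h3 := (hC' h hh).2
  rw [← integral_norm_fourier_sq h1 h2] at h3
  have h4 : Integrable (fun ξ => ‖𝓕 (ballShift d h) ξ‖ ^ 2) :=
    (memLp_fourier_two h1 h2).integrable_norm_pow two_ne_zero
  refine le_trans (le_of_eq ?_) (ENNReal.ofReal_le_ofReal h3)
  rw [ofReal_integral_eq_lintegral_ofReal h4 (ae_of_all _ fun ξ => by positivity)]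
  congr 1
  ext ξ
  rw [fourier_ballShift, norm_mul, mul_pow, Complex.norm_real, Real.norm_eq_abs, sq_abs]

theorem two_le_norm_fourierChar_sub_one_sq {s : ℝ} (h1 : 1 / 4 ≤ |s|) (h2 : |s| ≤ 1 / 2) :
    2 ≤ ‖(Real.fourierChar s : ℂ) - 1‖ ^ 2 := by
  have hcos : Real.cos (2 * Real.pi * s) ≤ 0 := by
    rw [← Real.cos_abs, abs_mul, abs_of_pos Real.two_pi_pos]
    apply Real.cos_nonpos_of_pi_div_two_le_of_le <;> nlinarith [Real.pi_pos]
  rw [Real.fourierChar_apply, ← Complex.normSq_eq_norm_sq, Complex.normSq_apply]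
  simp only [Complex.sub_re, Complex.sub_im, Complex.exp_ofReal_mul_I_re,
    Complex.exp_ofReal_mul_I_im, Complex.one_re, Complex.one_im]
  nlinarith [Real.sin_sq_add_cos_sq (2 * Real.pi * s)]

/-- A dyadic argument. Where |ξ_i| ≈ 2^k, translation by 2^{-k}/4 along the i-th axis has a
multiplier bounded below, so Plancherel shows that φ² has mass O(2^{-k}) there. The weight
contributes 2^{k/2}, leaving a geometric series of ratio √2/2. -/
theorem integrable_sqrt_norm_mul_ballFourier_sq (d : ℕ) :
    Integrable fun ξ : EuclideanSpace ℝ (Fin d) => √‖ξ‖ * ballFourier d ξ ^ 2 := by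
  obtain ⟨C, hC, hC'⟩ := lintegral_fourierChar_sub_one_le d
  let v : ℕ → Fin d → EuclideanSpace ℝ (Fin d) := fun k i =>
    EuclideanSpace.single i ((1 / 4) * (1 / 2) ^ k)
  have hv : ∀ k i, ‖v k i‖ = (1 / 4) * (1 / 2) ^ k := fun k i => by
    simp [v]
  have hv1 : ∀ k i, ‖v k i‖ ≤ 1 := fun k i => by
    rw [hv]
    have : (1 / 2 : ℝ) ^ k ≤ 1 := pow_le_one₀ (by norm_num) (by norm_num)
    linarith
  have hvi : ∀ k i ξ, inner ℝ (v k i) ξ = (1 / 4) * (1 / 2) ^ k * ξ i := fun k i ξ => by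
    simp [v, EuclideanSpace.inner_single_left]
  let W : ℕ → Fin d → EuclideanSpace ℝ (Fin d) → ℝ≥0∞ := fun k i ξ =>
    ENNReal.ofReal (‖(Real.fourierChar (inner ℝ (v k i) ξ) : ℂ) - 1‖ ^ 2 * ballFourier d ξ ^ 2)
  have hWm : ∀ k i, Measurable (W k i) := fun k i => by
    refine ENNReal.measurable_ofReal.comp (Continuous.measurable ?_)
    have hc : Continuous fun ξ : EuclideanSpace ℝ (Fin d) =>
        ((Real.fourierChar (inner ℝ (v k i) ξ) : Circle) : ℂ) :=
      continuous_subtype_val.comp (Real.continuous_fourierChar.comp (by fun_prop))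
    have := continuous_ballFourier (d := d)
    fun_prop
  have hφ : ∫⁻ ξ, ENNReal.ofReal (ballFourier d ξ ^ 2) < ∞ := by
    have h1 := (memLp_fourier_two integrable_ballIndicator
      (memLp_ballIndicator (d := d) 2)).integrable_norm_pow two_ne_zero
    simp only [norm_fourier_ballIndicator, sq_abs] at h1
    rw [← ofReal_integral_eq_lintegral_ofReal h1 (ae_of_all _ fun ξ => by positivity)]
    exact ENNReal.ofReal_lt_top
  have hpt : ∀ ξ : EuclideanSpace ℝ (Fin d), ENNReal.ofReal (√‖ξ‖ * ballFourier d ξ ^ 2)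
      ≤ ENNReal.ofReal √d * (ENNReal.ofReal (ballFourier d ξ ^ 2)
        + ∑' k : ℕ, ENNReal.ofReal (√(2 ^ k)) * ∑ i, W k i ξ) := by
    intro ξ
    have hφ0 : 0 ≤ ballFourier d ξ ^ 2 := sq_nonneg _
    have hsum : ∀ m : ℝ, (∀ i, |ξ i| ≤ m) → ‖ξ‖ ≤ d * m := fun m hm => by
      have h1 : ‖ξ‖ ≤ ∑ i, ‖ξ i‖ := by
        conv_lhs => rw [← (EuclideanSpace.basisFun (Fin d) ℝ).sum_repr ξ]
        refine (norm_sum_le _ _).trans (Finset.sum_le_sum fun i _ => ?_)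
        rw [norm_smul, (EuclideanSpace.basisFun (Fin d) ℝ).norm_eq_one, mul_one]
        simp
      refine h1.trans ((Finset.sum_le_card_nsmul _ _ m fun i _ => hm i).trans ?_)
      simp
    by_cases hle : ∀ i, |ξ i| ≤ 1
    · have h1 := hsum 1 hle
      rw [mul_one] at h1
      rw [ENNReal.ofReal_mul (Real.sqrt_nonneg _)]
      gcongr
      exact le_self_add
    · push Not at hle
      obtain ⟨i₀, hi₀⟩ := hle
      have : Nonempty (Fin d) := ⟨i₀⟩
      -- The largest coordinate satisfies ‖ξ‖ ≤ d |ξ_i|. With 2^k ≤ |ξ_i| < 2^{k+1}, the phase of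
      -- the k-th translation lies in [1/4, 1/2].
      obtain ⟨i, hi⟩ := Finite.exists_max (fun i => |ξ i|)
      obtain ⟨k, hk1, hk2⟩ := exists_nat_pow_near (hi₀.trans_le (hi i₀)).le one_lt_two
      have hs : |(1 / 4) * (1 / 2) ^ k * ξ i| = (1 / 4) * ((1 / 2) ^ k * |ξ i|) := by
        rw [abs_mul, abs_of_pos (by positivity), mul_assoc]
      have hk : (1 / 2 : ℝ) ^ k * 2 ^ k = 1 := by rw [← mul_pow]; norm_num
      have hW : 2 * ballFourier d ξ ^ 2
          ≤ ‖(Real.fourierChar (inner ℝ (v k i) ξ) : ℂ) - 1‖ ^ 2 * ballFourier d ξ ^ 2 := by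
        gcongr
        rw [hvi]
        have hp : (0 : ℝ) < (1 / 2) ^ k := by positivity
        refine two_le_norm_fourierChar_sub_one_sq ?_ ?_ <;> rw [hs]
        · nlinarith
        · rw [pow_succ] at hk2
          nlinarith
      have hmain : √‖ξ‖ ≤ √d * (√(2 ^ k) * 2) := by
        calc √‖ξ‖ ≤ √(d * (2 ^ k * 2 ^ 2)) := by
              gcongr
              refine (hsum _ hi).trans ?_
              gcongr
              rw [pow_succ] at hk2
              have : (0 : ℝ) < 2 ^ k := by positivity
              linarith
          _ = _ := by
              rw [Real.sqrt_mul (by positivity), Real.sqrt_mul (by positivity),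
                Real.sqrt_sq (by norm_num)]
      calc ENNReal.ofReal (√‖ξ‖ * ballFourier d ξ ^ 2)
          ≤ ENNReal.ofReal (√d * (√(2 ^ k) * (2 * ballFourier d ξ ^ 2))) := by
            refine ENNReal.ofReal_le_ofReal ?_
            have := mul_le_mul_of_nonneg_right hmain hφ0
            linarith
        _ = ENNReal.ofReal √d * (ENNReal.ofReal √(2 ^ k)
              * ENNReal.ofReal (2 * ballFourier d ξ ^ 2)) := by
            rw [ENNReal.ofReal_mul (by positivity), ENNReal.ofReal_mul (by positivity)]
        _ ≤ ENNReal.ofReal √d * (ENNReal.ofReal √(2 ^ k) * ∑ i, W k i ξ) := by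
            gcongr
            exact (ENNReal.ofReal_le_ofReal hW).trans
              (Finset.single_le_sum (f := fun i => W k i ξ) (fun _ _ => zero_le) (Finset.mem_univ i))
        _ ≤ _ := by
            gcongr
            exact (ENNReal.le_tsum (f := fun k : ℕ => ENNReal.ofReal √(2 ^ k) * ∑ i, W k i ξ)
              k).trans le_add_self
  have hlt : ∫⁻ ξ : EuclideanSpace ℝ (Fin d), ENNReal.ofReal √d
      * (ENNReal.ofReal (ballFourier d ξ ^ 2)
        + ∑' k : ℕ, ENNReal.ofReal (√(2 ^ k)) * ∑ i, W k i ξ) < ∞ := by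
    have hm : ∀ k, Measurable fun ξ => ENNReal.ofReal √(2 ^ k) * ∑ i, W k i ξ := fun k =>
      (Finset.measurable_fun_sum _ fun i _ => hWm k i).const_mul _
    have hm1 : Measurable fun ξ : EuclideanSpace ℝ (Fin d) =>
        ENNReal.ofReal (ballFourier d ξ ^ 2) :=
      ENNReal.measurable_ofReal.comp (continuous_ballFourier.pow 2).measurable
    rw [lintegral_const_mul' _ _ ENNReal.ofReal_ne_top, lintegral_add_left hm1,
      lintegral_tsum fun k => (hm k).aemeasurable]
    refine ENNReal.mul_lt_top ENNReal.ofReal_lt_top (ENNReal.add_lt_top.2 ⟨hφ, ?_⟩)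
    have hk : ∀ k : ℕ, ∫⁻ ξ, ENNReal.ofReal √(2 ^ k) * ∑ i, W k i ξ
        ≤ ENNReal.ofReal ((√2 / 2) ^ k * (d * (C / 4))) := fun k => by
      rw [lintegral_const_mul _ (Finset.measurable_fun_sum _ fun i _ => hWm k i),
        lintegral_finsetSum _ fun i _ => hWm k i]
      have h1 : ∑ i, ∫⁻ ξ, W k i ξ ≤ ENNReal.ofReal (d * (C * ((1 / 4) * (1 / 2) ^ k))) := by
        refine (Finset.sum_le_card_nsmul _ _ (ENNReal.ofReal (C * ((1 / 4) * (1 / 2) ^ k)))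
          fun i _ => hv k i ▸ hC' (v k i) (hv1 k i)).trans (le_of_eq ?_)
        rw [Finset.card_univ, Fintype.card_fin, nsmul_eq_mul,
          ENNReal.ofReal_mul (by positivity : (0 : ℝ) ≤ d), ENNReal.ofReal_natCast]
      refine (mul_le_mul_right h1 _).trans (le_of_eq ?_)
      rw [← ENNReal.ofReal_mul (by positivity)]
      congr 1
      have : √(2 ^ k) = √2 ^ k := by
        rw [Real.sqrt_eq_iff_mul_self_eq (by positivity) (by positivity), ← mul_pow,
          Real.mul_self_sqrt (by norm_num)]
      rw [this, div_pow, div_pow, one_pow]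
      field_simp
    refine lt_of_le_of_lt (ENNReal.tsum_le_tsum hk) ?_
    have hs : Summable fun k : ℕ => (√2 / 2) ^ k * (d * (C / 4)) := by
      refine (summable_geometric_of_lt_one (by positivity) ?_).mul_right _
      have : √2 < 2 := by rw [Real.sqrt_lt' (by norm_num)]; norm_num
      linarith
    exact lt_top_iff_ne_top.2 hs.tsum_ofReal_ne_top
  refine ⟨?_, ?_⟩
  · have := continuous_ballFourier (d := d)
    exact (Continuous.aestronglyMeasurable (by fun_prop))
  · rw [hasFiniteIntegral_iff_ofReal (ae_of_all _ fun ξ => by positivity)]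
    exact (lintegral_mono hpt).trans_lt hlt

theorem integrable_ballFourier_sq : Integrable fun ξ => ballFourier d ξ ^ 2 := by
  have h1 := (memLp_fourier_two integrable_ballIndicator
    (memLp_ballIndicator (d := d) 2)).integrable_norm_pow two_ne_zero
  simpa only [norm_fourier_ballIndicator, sq_abs] using h1

/-- Since φ is bounded, the smallest exponent of a range dominates all the others. This makes the
dominating functions below uniform in the exponent. -/
theorem abs_ballFourier_rpow_le {s₀ s S : ℝ} (h0 : 0 ≤ s₀) (h1 : s₀ ≤ s) (h2 : s ≤ S)
    (ξ : EuclideanSpace ℝ (Fin d)) :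
    |ballFourier d ξ| ^ s ≤ |ballFourier d ξ| ^ s₀ * (1 + volume.real (unitBall d)) ^ S := by
  have hv : 0 ≤ volume.real (unitBall d) := measureReal_nonneg
  calc |ballFourier d ξ| ^ s = |ballFourier d ξ| ^ s₀ * |ballFourier d ξ| ^ (s - s₀) := by
        rw [← Real.rpow_add_of_nonneg (abs_nonneg _) h0 (by linarith)]; congr 1; ring
    _ ≤ |ballFourier d ξ| ^ s₀ * (1 + volume.real (unitBall d)) ^ (s - s₀) := by
        gcongr
        linarith [abs_ballFourier_le ξ]
    _ ≤ _ := by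
        gcongr <;> linarith

/-- The decay of φ gives ‖ξ‖ |φ|^{1/2} ≤ C ‖ξ‖^{1/2}, so the case s = 5/2 is controlled by φ² and
‖ξ‖^{1/2} φ². The bound is applied with s = q - 1, whence the condition q ≥ 7/2 later on. -/
theorem exists_integrable_bound_weighted (d : ℕ) (S : ℝ) :
    ∃ H : EuclideanSpace ℝ (Fin d) → ℝ, Integrable H ∧
      ∀ s, 5 / 2 ≤ s → s ≤ S → ∀ ξ, (1 + ‖ξ‖) * |ballFourier d ξ| ^ s ≤ H ξ := by
  obtain ⟨C, hC, hC'⟩ := exists_norm_mul_abs_ballFourier_le d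
  set v := volume.real (unitBall d) with hvdef
  have hv : 0 ≤ v := measureReal_nonneg
  refine ⟨fun ξ => (√v * ballFourier d ξ ^ 2 + √C * (√‖ξ‖ * ballFourier d ξ ^ 2)) * (1 + v) ^ S,
    ((integrable_ballFourier_sq.const_mul _).add
      ((integrable_sqrt_norm_mul_ballFourier_sq d).const_mul _)).mul_const _,
    fun s h1 h2 ξ => ?_⟩
  have h3 := abs_ballFourier_rpow_le (s₀ := 5 / 2) (by norm_num) h1 h2 ξ
  rw [← hvdef] at h3
  have h4 : |ballFourier d ξ| ^ (5 / 2 : ℝ) = ballFourier d ξ ^ 2 * √|ballFourier d ξ| := by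
    rw [show (5 / 2 : ℝ) = (2 : ℕ) + 1 / 2 by norm_num,
      Real.rpow_add_of_nonneg (abs_nonneg _) (by norm_num) (by norm_num), Real.rpow_natCast,
      sq_abs, Real.sqrt_eq_rpow]
  have h5 : √|ballFourier d ξ| ≤ √v := Real.sqrt_le_sqrt (abs_ballFourier_le ξ)
  have h6 : ‖ξ‖ * √|ballFourier d ξ| ≤ √C * √‖ξ‖ := by
    calc ‖ξ‖ * √|ballFourier d ξ| = √‖ξ‖ * √(‖ξ‖ * |ballFourier d ξ|) := by
          rw [Real.sqrt_mul (norm_nonneg _), ← mul_assoc, Real.mul_self_sqrt (norm_nonneg _)]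
      _ ≤ √‖ξ‖ * √C := by gcongr; exact hC' ξ
      _ = _ := mul_comm _ _
  calc (1 + ‖ξ‖) * |ballFourier d ξ| ^ s
      ≤ (1 + ‖ξ‖) * (|ballFourier d ξ| ^ (5 / 2 : ℝ) * (1 + v) ^ S) := by gcongr
    _ = (√|ballFourier d ξ| + ‖ξ‖ * √|ballFourier d ξ|) * ballFourier d ξ ^ 2 * (1 + v) ^ S := by
        rw [h4]; ring
    _ ≤ (√v + √C * √‖ξ‖) * ballFourier d ξ ^ 2 * (1 + v) ^ S := by gcongr
    _ = _ := by ring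

/-- Exponents slightly below 2 are needed because q - 2 can be less than 2 when q is near 4. Where
|φ| is below (1 + ‖ξ‖)^{-(d+1)}, that power is itself integrable and dominates. Elsewhere |φ|^{-ρ}
is at most a power of 1 + ‖ξ‖, absorbed by the weight ‖ξ‖^{1/2} on φ². -/
theorem exists_integrable_bound_subquadratic (d : ℕ) :
    ∃ ρ : ℝ, 0 < ρ ∧ ρ ≤ 1 / 2 ∧ ∀ S : ℝ, ∃ H : EuclideanSpace ℝ (Fin d) → ℝ, Integrable H ∧
      ∀ s, 2 - ρ ≤ s → s ≤ S → ∀ ξ, |ballFourier d ξ| ^ s ≤ H ξ := by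
  -- Chosen so that (d + 1) ρ = 1/2, the exponent of the available weight.
  set ρ : ℝ := 1 / (2 * (d + 1)) with hρ
  have hρ0 : 0 < ρ := by positivity
  have hρ1 : ρ ≤ 1 / 2 := by
    rw [hρ, div_le_div_iff₀ (by positivity) (by norm_num)]
    have : (0 : ℝ) ≤ d := by positivity
    linarith
  refine ⟨ρ, hρ0, hρ1, fun S => ?_⟩
  set v := volume.real (unitBall d) with hvdef
  have hv : 0 ≤ v := measureReal_nonneg
  refine ⟨fun ξ => (ballFourier d ξ ^ 2 + √‖ξ‖ * ballFourier d ξ ^ 2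
      + (1 + ‖ξ‖) ^ (-((d : ℝ) + 1))) * (1 + v) ^ S,
    ((integrable_ballFourier_sq.add (integrable_sqrt_norm_mul_ballFourier_sq d)).add
      (integrable_one_add_norm (by simp))).mul_const _, fun s h1 h2 ξ => ?_⟩
  refine (abs_ballFourier_rpow_le (by linarith) h1 h2 ξ).trans ?_
  rw [← hvdef]
  refine mul_le_mul_of_nonneg_right ?_ (by positivity)
  set u := |ballFourier d ξ| with hu
  have hu0 : 0 ≤ u := abs_nonneg _
  have hw : 1 ≤ 1 + ‖ξ‖ := by linarith [norm_nonneg ξ]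
  have hw0 : 0 < 1 + ‖ξ‖ := by linarith
  rw [← sq_abs, ← hu]
  rcases le_or_gt u ((1 + ‖ξ‖) ^ (-((d : ℝ) + 1))) with h | h
  · have e1 : u ^ (2 - ρ) ≤ (1 + ‖ξ‖) ^ (-((d : ℝ) + 1)) := by
      calc u ^ (2 - ρ) ≤ ((1 + ‖ξ‖) ^ (-((d : ℝ) + 1))) ^ (2 - ρ) := by gcongr; linarith
        _ = (1 + ‖ξ‖) ^ (-((d : ℝ) + 1) * (2 - ρ)) := by rw [Real.rpow_mul hw0.le]
        _ ≤ _ := by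
            apply Real.rpow_le_rpow_of_exponent_le hw
            have : (0 : ℝ) ≤ d := by positivity
            nlinarith
    have : 0 ≤ u ^ 2 + √‖ξ‖ * u ^ 2 := by positivity
    linarith
  · have hupos : 0 < u := lt_trans (by positivity) h
    have e1 : u ^ (-ρ) ≤ √(1 + ‖ξ‖) := by
      calc u ^ (-ρ) ≤ ((1 + ‖ξ‖) ^ (-((d : ℝ) + 1))) ^ (-ρ) :=
            Real.rpow_le_rpow_of_nonpos (by positivity) h.le (by linarith)
        _ = (1 + ‖ξ‖) ^ (1 / 2 : ℝ) := by
            rw [← Real.rpow_mul hw0.le]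
            congr 1
            rw [hρ]
            field_simp
        _ = _ := by rw [Real.sqrt_eq_rpow]
    have e2 : √(1 + ‖ξ‖) ≤ 1 + √‖ξ‖ := by
      rw [Real.sqrt_le_left (by positivity)]
      nlinarith [Real.sq_sqrt (norm_nonneg ξ), Real.sqrt_nonneg ‖ξ‖]
    have e3 : u ^ (2 - ρ) = u ^ 2 * u ^ (-ρ) := by
      rw [← Real.rpow_natCast u 2, ← Real.rpow_add hupos]
      norm_num [sub_eq_add_neg]
    have e4 : 0 ≤ (1 + ‖ξ‖) ^ (-((d : ℝ) + 1)) := by positivity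
    rw [e3]
    nlinarith [mul_le_mul_of_nonneg_left (e1.trans e2) (sq_nonneg u)]

end BallFourierIntegrability

/-! ### Reflection in the perpendicular bisector of two points. -/

section BisectorReflection

variable {V : Type*} [NormedAddCommGroup V] [InnerProductSpace ℝ V]

/-- Reflection in the perpendicular bisector of `x` and `x'`. -/
noncomputable def bisectorReflection (x x' : V) : V ≃ₜ V :=
  ((Homeomorph.subRight (midpoint ℝ x x')).trans
    (Submodule.reflection (ℝ ∙ (x' - x))ᗮ).toHomeomorph).trans
    (Homeomorph.addRight (midpoint ℝ x x'))

theorem bisectorReflection_apply (x x' y : V) :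
    bisectorReflection x x' y
      = y - (2 * (inner ℝ (x' - x) (y - midpoint ℝ x x') / ‖x' - x‖ ^ 2)) • (x' - x) := by
  change (Submodule.reflection (ℝ ∙ (x' - x))ᗮ) (y - midpoint ℝ x x') + midpoint ℝ x x' = _
  rw [Submodule.reflection_orthogonal_apply, Submodule.reflection_singleton_apply, two_smul,
    mul_smul, two_smul]
  simp only [RCLike.ofReal_real_eq_id, id_eq]
  abel

theorem bisectorReflection_involutive (x x' y : V) :
    bisectorReflection x x' (bisectorReflection x x' y) = y := by
  change (Submodule.reflection (ℝ ∙ (x' - x))ᗮ)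
    ((Submodule.reflection (ℝ ∙ (x' - x))ᗮ) (y - midpoint ℝ x x') + midpoint ℝ x x'
      - midpoint ℝ x x') + midpoint ℝ x x' = y
  rw [add_sub_cancel_right, Submodule.reflection_reflection, sub_add_cancel]

/-- This translates the side of the bisector on which `y` lies into a comparison of its distances to
`x` and `x'`. -/
theorem inner_sub_midpoint (x x' y : V) :
    2 * inner ℝ (x' - x) (y - midpoint ℝ x x') = ‖y - x‖ ^ 2 - ‖y - x'‖ ^ 2 := by
  have h1 : y - midpoint ℝ x x' = (1 / 2 : ℝ) • ((y - x) + (y - x')) := by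
    rw [midpoint_eq_smul_add, invOf_eq_inv]; module
  have h2 : x' - x = (y - x) - (y - x') := by abel
  rw [h1, h2, inner_smul_right]
  generalize y - x = p
  generalize y - x' = q
  rw [inner_add_right, inner_sub_left, inner_sub_left,
    real_inner_self_eq_norm_sq, real_inner_self_eq_norm_sq, real_inner_comm p]
  ring

theorem norm_bisectorReflection_sub_left {x x' : V} (hx : x ≠ x') (y : V) :
    ‖bisectorReflection x x' y - x‖ = ‖y - x'‖ := by
  have hw : 0 < ‖x' - x‖ ^ 2 := by
    have := norm_pos_iff.2 (sub_ne_zero.2 hx.symm); positivity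
  rw [← sq_eq_sq₀ (norm_nonneg _) (norm_nonneg _), bisectorReflection_apply]
  have h := inner_sub_midpoint x x' y
  set w := x' - x with hwdef
  set s := 2 * (inner ℝ w (y - midpoint ℝ x x') / ‖w‖ ^ 2)
  have hs : s * ‖w‖ ^ 2 = ‖y - x‖ ^ 2 - ‖y - x'‖ ^ 2 := by
    rw [← h]; simp only [s]; rw [mul_assoc, div_mul_cancel₀ _ hw.ne']
  have e1 : y - s • w - x = (y - x) - s • w := by abel
  have e2 : y - x' = (y - x) - w := by rw [hwdef]; abel
  have e3 : ‖y - x'‖ ^ 2 = ‖y - x‖ ^ 2 - 2 * inner ℝ (y - x) w + ‖w‖ ^ 2 := by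
    rw [e2, norm_sub_sq_real]
  rw [e1, norm_sub_sq_real, inner_smul_right, norm_smul, mul_pow, Real.norm_eq_abs, sq_abs]
  have : ‖y - x‖ ^ 2 - 2 * (s * inner ℝ (y - x) w) + s ^ 2 * ‖w‖ ^ 2
      = ‖y - x‖ ^ 2 - s * (2 * inner ℝ (y - x) w - s * ‖w‖ ^ 2) := by ring
  rw [this, hs, e3]
  nlinarith

theorem norm_bisectorReflection_sub_right {x x' : V} (hx : x ≠ x') (y : V) :
    ‖bisectorReflection x x' y - x'‖ = ‖y - x‖ := by
  rw [← norm_bisectorReflection_sub_left hx, bisectorReflection_involutive]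

/-- The condition ‖x‖ ≤ ‖x'‖ puts the origin on the side of `x`. Reflecting a point of that side
across the bisector moves it away from the origin. -/
theorem norm_le_norm_bisectorReflection {x x' y : V} (hx : x ≠ x') (h : ‖x‖ ≤ ‖x'‖)
    (hy : ‖y - x‖ ≤ ‖y - x'‖) : ‖y‖ ≤ ‖bisectorReflection x x' y‖ := by
  have hw : 0 < ‖x' - x‖ ^ 2 := by
    have := norm_pos_iff.2 (sub_ne_zero.2 hx.symm); positivity
  rw [← sq_le_sq₀ (norm_nonneg _) (norm_nonneg _), bisectorReflection_apply]
  have h1 := inner_sub_midpoint x x' y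
  have h0 := inner_sub_midpoint x x' (0 : V)
  simp only [zero_sub, norm_neg, inner_neg_right] at h0
  rw [inner_sub_right] at h1
  set w := x' - x with hwdef
  set m := midpoint ℝ x x'
  have hsq1 : ‖y - x‖ ^ 2 ≤ ‖y - x'‖ ^ 2 := by gcongr
  have hsq2 : ‖x‖ ^ 2 ≤ ‖x'‖ ^ 2 := by gcongr
  rw [inner_sub_right]
  set s := 2 * ((inner ℝ w y - inner ℝ w m) / ‖w‖ ^ 2) with hs
  have hs' : s * ‖w‖ ^ 2 = 2 * (inner ℝ w y - inner ℝ w m) := by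
    rw [hs, mul_assoc, div_mul_cancel₀ _ hw.ne']
  have hs0 : s ≤ 0 := by
    by_contra hcon
    have := mul_pos (not_le.1 hcon) hw
    linarith
  rw [norm_sub_sq_real, inner_smul_right, norm_smul, mul_pow, Real.norm_eq_abs, sq_abs,
    real_inner_comm]
  have : s ^ 2 * ‖w‖ ^ 2 = s * (s * ‖w‖ ^ 2) := by ring
  rw [this, hs']
  nlinarith

theorem measurePreserving_bisectorReflection [FiniteDimensional ℝ V] [MeasurableSpace V] [BorelSpace V]
    (x x' : V) :
    MeasurePreserving (bisectorReflection x x') volume volume :=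
  ((measurePreserving_add_right volume (midpoint ℝ x x')).comp
    (Submodule.reflection (ℝ ∙ (x' - x))ᗮ).measurePreserving).comp
    (measurePreserving_sub_right volume (midpoint ℝ x x'))

end BisectorReflection

/-! ### Convolution with the ball: monotonicity and a quantitative slope. -/

section BallAverage

open scoped Pointwise

variable {d : ℕ}

/-- The convolution of `u` with the indicator function of the unit ball. -/
noncomputable def ballAverage (u : EuclideanSpace ℝ (Fin d) → ℝ) (x : EuclideanSpace ℝ (Fin d)) :
    ℝ :=
  ∫ y, (Metric.closedBall x 1).indicator u y

/-- Nonnegative bounded integrable functions, nonincreasing in the norm of the variable, with a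
quantitative drop across the unit sphere. -/
structure IsRadialProfile (u : EuclideanSpace ℝ (Fin d) → ℝ) : Prop where
  measurable : Measurable u
  integrable : Integrable u
  nonneg : ∀ x, 0 ≤ u x
  bounded : ∃ C, ∀ x, u x ≤ C
  anti : ∀ x y, ‖x‖ ≤ ‖y‖ → u y ≤ u x
  drop : ∃ a b, b < a ∧ (∀ x, ‖x‖ ≤ 7 / 8 → a ≤ u x) ∧ (∀ x, 9 / 8 ≤ ‖x‖ → u x ≤ b)

/-- The reflection preserves volume and swaps the unit balls about `x` and `x'`, which gives a
second expression for the difference of averages. Adding the two produces an integrand of constant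
sign when `u` is radially nonincreasing. -/
theorem ballAverage_sub_ballAverage {u : EuclideanSpace ℝ (Fin d) → ℝ} (hu : Integrable u)
    {x x' : EuclideanSpace ℝ (Fin d)} (hx : x ≠ x') :
    2 * (ballAverage u x - ballAverage u x')
      = ∫ y, ((Metric.closedBall x 1).indicator (fun _ => (1 : ℝ)) y
          - (Metric.closedBall x' 1).indicator (fun _ => (1 : ℝ)) y)
          * (u y - u (bisectorReflection x x' y)) := by
  set σ := bisectorReflection x x'
  have hσ := measurePreserving_bisectorReflection x x'
  have hσe : MeasurableEmbedding σ := σ.measurableEmbedding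
  have huσ : Integrable (fun y => u (σ y)) := hσ.integrable_comp_of_integrable hu
  have hB : ∀ z : EuclideanSpace ℝ (Fin d), MeasurableSet (Metric.closedBall z 1) :=
    fun z => Metric.isClosed_closedBall.measurableSet
  have e1 : ballAverage u x = ∫ y, (Metric.closedBall x' 1).indicator (fun y => u (σ y)) y := by
    rw [ballAverage, ← hσ.integral_comp hσe]
    refine integral_congr_ae (ae_of_all _ fun y => ?_)
    have hmem : σ y ∈ Metric.closedBall x 1 ↔ y ∈ Metric.closedBall x' 1 := by
      rw [Metric.mem_closedBall, Metric.mem_closedBall, dist_eq_norm, dist_eq_norm,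
        norm_bisectorReflection_sub_left hx]
    change (Metric.closedBall x 1).indicator u (σ y) = _
    by_cases hy : y ∈ Metric.closedBall x' 1
    · rw [Set.indicator_of_mem hy, Set.indicator_of_mem (hmem.2 hy)]
    · rw [Set.indicator_of_notMem hy, Set.indicator_of_notMem (mt hmem.1 hy)]
  have e2 : ballAverage u x' = ∫ y, (Metric.closedBall x 1).indicator (fun y => u (σ y)) y := by
    rw [ballAverage, ← hσ.integral_comp hσe]
    refine integral_congr_ae (ae_of_all _ fun y => ?_)
    have hmem : σ y ∈ Metric.closedBall x' 1 ↔ y ∈ Metric.closedBall x 1 := by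
      rw [Metric.mem_closedBall, Metric.mem_closedBall, dist_eq_norm, dist_eq_norm,
        norm_bisectorReflection_sub_right hx]
    change (Metric.closedBall x' 1).indicator u (σ y) = _
    by_cases hy : y ∈ Metric.closedBall x 1
    · rw [Set.indicator_of_mem hy, Set.indicator_of_mem (hmem.2 hy)]
    · rw [Set.indicator_of_notMem hy, Set.indicator_of_notMem (mt hmem.1 hy)]
  have e3 : 2 * (ballAverage u x - ballAverage u x') = (ballAverage u x - ballAverage u x')
      - (ballAverage u x' - ballAverage u x) := by ring
  rw [e3]
  conv_lhs => rhs; rw [e1, e2]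
  rw [ballAverage, ballAverage, ← integral_sub (hu.indicator (hB x)) (hu.indicator (hB x')),
    ← integral_sub (huσ.indicator (hB x)) (huσ.indicator (hB x')), ← integral_sub]
  · congr 1
    ext y
    by_cases h1 : y ∈ Metric.closedBall x 1 <;> by_cases h2 : y ∈ Metric.closedBall x' 1 <;>
      simp [h1, h2]
    ring
  · exact (hu.indicator (hB x)).sub (hu.indicator (hB x'))
  · exact (huσ.indicator (hB x)).sub (huσ.indicator (hB x'))

/-- A point in only the ball about `x` is nearer to `x`, so reflection moves it outwards and `u`
does not increase. For a point in only the other ball, both factors change sign. -/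
theorem ballAverage_integrand_nonneg {u : EuclideanSpace ℝ (Fin d) → ℝ}
    (hu : ∀ x y, ‖x‖ ≤ ‖y‖ → u y ≤ u x) {x x' : EuclideanSpace ℝ (Fin d)} (hx : x ≠ x')
    (h : ‖x‖ ≤ ‖x'‖) (y : EuclideanSpace ℝ (Fin d)) :
    0 ≤ ((Metric.closedBall x 1).indicator (fun _ => (1 : ℝ)) y
          - (Metric.closedBall x' 1).indicator (fun _ => (1 : ℝ)) y)
          * (u y - u (bisectorReflection x x' y)) := by
  by_cases h1 : y ∈ Metric.closedBall x 1 <;> by_cases h2 : y ∈ Metric.closedBall x' 1 <;>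
    simp only [h1, h2, Set.indicator_of_mem, Set.indicator_of_notMem, not_false_eq_true, sub_self,
      zero_mul, le_refl, sub_zero, one_mul, zero_sub, neg_mul, neg_sub]
  · rw [Metric.mem_closedBall, dist_eq_norm] at h1 h2
    exact sub_nonneg.2 (hu _ _ (norm_le_norm_bisectorReflection hx h (by linarith)))
  · rw [Metric.mem_closedBall, dist_eq_norm] at h1 h2
    refine sub_nonneg.2 (hu _ _ ?_)
    have := norm_le_norm_bisectorReflection (y := bisectorReflection x x' y) hx h
      (by rw [norm_bisectorReflection_sub_left hx, norm_bisectorReflection_sub_right hx]; linarith)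
    rwa [bisectorReflection_involutive] at this

theorem ballAverage_anti {u : EuclideanSpace ℝ (Fin d) → ℝ} (hu : Integrable u)
    (hanti : ∀ x y, ‖x‖ ≤ ‖y‖ → u y ≤ u x) (x x' : EuclideanSpace ℝ (Fin d))
    (h : ‖x‖ ≤ ‖x'‖) : ballAverage u x' ≤ ballAverage u x := by
  rcases eq_or_ne x x' with rfl | hx
  · exact le_rfl
  · have h1 := ballAverage_sub_ballAverage hu hx
    have h2 : 0 ≤ 2 * (ballAverage u x - ballAverage u x') :=
      h1 ▸ integral_nonneg (ballAverage_integrand_nonneg hanti hx h)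
    linarith

theorem ofReal_ballAverage (u : EuclideanSpace ℝ (Fin d) → ℝ) (x : EuclideanSpace ℝ (Fin d)) :
    (ballAverage u x : ℂ) = ∫ t, (u t : ℂ) * ballIndicator d (x - t) := by
  rw [ballAverage, ← integral_complex_ofReal]
  refine integral_congr_ae (ae_of_all _ fun t => ?_)
  have hmem : t ∈ Metric.closedBall x 1 ↔ x - t ∈ unitBall d := by
    rw [unitBall, Metric.mem_closedBall, mem_closedBall_zero_iff, dist_comm, dist_eq_norm]
  by_cases ht : t ∈ Metric.closedBall x 1
  · simp only [ballIndicator, Set.indicator_of_mem ht, Set.indicator_of_mem (hmem.1 ht), mul_one]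
  · simp only [ballIndicator, Set.indicator_of_notMem ht,
      Set.indicator_of_notMem (mt hmem.2 ht), mul_zero, Complex.ofReal_zero]

theorem ofReal_ballAverage_eq_convolution (u : EuclideanSpace ℝ (Fin d) → ℝ) :
    (fun x => (ballAverage u x : ℂ))
      = convolution (fun x => (u x : ℂ)) (ballIndicator d) (ContinuousLinearMap.mul ℂ ℂ) := by
  ext x
  rw [ofReal_ballAverage]
  rfl

theorem integrable_ballAverage {u : EuclideanSpace ℝ (Fin d) → ℝ} (hu : Integrable u) :
    Integrable (ballAverage u) := by
  have h : Integrable fun x => (ballAverage u x : ℂ) := by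
    rw [ofReal_ballAverage_eq_convolution]
    exact hu.ofReal.integrable_convolution _ integrable_ballIndicator
  exact h.re

theorem fourier_ballAverage {u : EuclideanSpace ℝ (Fin d) → ℝ} (hu : Integrable u) (ξ) :
    𝓕 (fun x => (ballAverage u x : ℂ)) ξ = 𝓕 (fun x => (u x : ℂ)) ξ * ballFourier d ξ := by
  rw [ofReal_ballAverage_eq_convolution, ofReal_ballFourier]
  exact Real.fourier_mul_convolution_eq hu.ofReal integrable_ballIndicator ξ

theorem continuous_ballAverage {u : EuclideanSpace ℝ (Fin d) → ℝ} (hu : Integrable u)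
    {C : ℝ} (hC : ∀ x, |u x| ≤ C) : Continuous (ballAverage u) := by
  obtain ⟨K, hK, hK'⟩ := exists_integral_norm_ballShift_le d
  have hC0 : 0 ≤ C := (abs_nonneg _).trans (hC 0)
  have hint : ∀ x, Integrable fun t => (u t : ℂ) * ballIndicator d (x - t) := fun x =>
    (integrable_ballIndicator.comp_sub_left x).bdd_mul hu.ofReal.aestronglyMeasurable (c := C)
      (ae_of_all _ fun t => by rw [Complex.norm_real]; exact hC t)
  have key : ∀ x h, ‖h‖ ≤ 1 → |ballAverage u (x + h) - ballAverage u x| ≤ C * K * ‖h‖ := by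
    intro x h hh
    have hi : Integrable fun t => ‖ballShift d h (x - t)‖ :=
      ((memLp_one_iff_integrable.1 (memLp_ballShift 1 h)).comp_sub_left x).norm
    rw [← Real.norm_eq_abs, ← Complex.norm_real, Complex.ofReal_sub, ofReal_ballAverage,
      ofReal_ballAverage, ← integral_sub (hint _) (hint _)]
    calc _ ≤ ∫ t, C * ‖ballShift d h (x - t)‖ := by
          refine norm_integral_le_of_norm_le (hi.const_mul C) (ae_of_all _ fun t => ?_)
          rw [← mul_sub, norm_mul, Complex.norm_real, ballShift, Pi.sub_apply, sub_add_eq_add_sub]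
          gcongr
          exact hC t
      _ = C * ∫ t, ‖ballShift d h t‖ := by
          rw [integral_const_mul, integral_sub_left_eq_self (fun t => ‖ballShift d h t‖)]
      _ ≤ C * (K * ‖h‖) := by gcongr; exact (hK' h hh).1
      _ = _ := by ring
  refine continuous_iff_continuousAt.2 fun x => Metric.continuousAt_iff.2 fun ε hε => ?_
  refine ⟨min 1 (ε / (C * K + 1)), by positivity, fun y hy => ?_⟩
  rw [dist_eq_norm] at hy
  have h1 := key x (y - x) (hy.le.trans (min_le_left _ _))
  rw [add_sub_cancel] at h1
  rw [Real.dist_eq]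
  have h2 := hy.trans_le (min_le_right _ _)
  rw [lt_div_iff₀ (by positivity)] at h2
  nlinarith [norm_nonneg (y - x)]

/-- The truncated spherical cap around `e` used to bound volumes from below. -/
def cone (e : EuclideanSpace ℝ (Fin d)) : Set (EuclideanSpace ℝ (Fin d)) :=
  {z | ‖z‖ ≤ 1 ∧ 3 / 4 * ‖z‖ ≤ inner ℝ z e}

theorem isClosed_cone (e : EuclideanSpace ℝ (Fin d)) : IsClosed (cone e) :=
  (isClosed_le continuous_norm continuous_const).inter
    (isClosed_le (continuous_const.mul continuous_norm) (continuous_id.inner continuous_const))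

theorem volume_cone_lt_top (e : EuclideanSpace ℝ (Fin d)) : volume (cone e) < ∞ :=
  (measure_mono fun _ hz => mem_closedBall_zero_iff.2 hz.1).trans_lt
    (measure_closedBall_lt_top (x := (0 : EuclideanSpace ℝ (Fin d))) (r := 1))

theorem smul_cone {e : EuclideanSpace ℝ (Fin d)} {l : ℝ} (hl : 0 < l) :
    l • cone e = {z | ‖z‖ ≤ l ∧ 3 / 4 * ‖z‖ ≤ inner ℝ z e} := by
  ext z
  rw [Set.mem_smul_set_iff_inv_smul_mem₀ hl.ne']
  simp only [cone, Set.mem_ofPred_eq, norm_smul, norm_inv, Real.norm_of_nonneg hl.le,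
    real_inner_smul_left]
  constructor
  · rintro ⟨h1, h2⟩
    rw [inv_mul_le_iff₀ hl, mul_one] at h1
    refine ⟨h1, ?_⟩
    have := mul_le_mul_of_nonneg_left h2 hl.le
    field_simp at this
    linarith
  · rintro ⟨h1, h2⟩
    rw [inv_mul_le_iff₀ hl, mul_one]
    refine ⟨h1, ?_⟩
    have := mul_le_mul_of_nonneg_left h2 (inv_pos.2 hl).le
    linarith

/-- By scaling the volume is (1 - l^d)|cone|, with l^d ≤ l as d ≥ 1. The ball of radius 1/20 about
e/2 lies in the cone, which gives a lower bound independent of `e`. -/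
theorem volume_real_cone_diff_ge (hd : 1 ≤ d) {e : EuclideanSpace ℝ (Fin d)} (he : ‖e‖ = 1)
    {l : ℝ} (hl : 0 < l) (hl1 : l ≤ 1) :
    (1 - l) * volume.real (Metric.ball (0 : EuclideanSpace ℝ (Fin d)) (1 / 20))
      ≤ volume.real (cone e \ l • cone e) := by
  have hball : Metric.ball ((1 / 2 : ℝ) • e) (1 / 20) ⊆ cone e := by
    intro z hz
    rw [Metric.mem_ball, dist_eq_norm] at hz
    have h1 : ‖z‖ ≤ ‖z - (1 / 2 : ℝ) • e‖ + ‖(1 / 2 : ℝ) • e‖ := norm_le_norm_sub_add _ _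
    have h2 : ‖(1 / 2 : ℝ) • e‖ = 1 / 2 := by rw [norm_smul, he]; norm_num
    have h3 : inner ℝ z e = inner ℝ (z - (1 / 2 : ℝ) • e) e + 1 / 2 := by
      rw [inner_sub_left, real_inner_smul_left, real_inner_self_eq_norm_sq, he]; ring
    have h4 := abs_real_inner_le_norm (z - (1 / 2 : ℝ) • e) e
    rw [he, mul_one] at h4
    have h5 := (abs_le.1 h4).1
    exact ⟨by linarith, by linarith⟩
  have hsub : l • cone e ⊆ cone e := by
    rw [smul_cone hl]
    exact fun z hz => ⟨hz.1.trans hl1, hz.2⟩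
  have hmeas : MeasurableSet (l • cone e) := (isClosed_cone e).measurableSet.const_smul₀ l
  have hvol : volume.real (l • cone e) = l ^ d * volume.real (cone e) := by
    rw [measureReal_def, Measure.addHaar_smul_of_nonneg _ hl.le, ENNReal.toReal_mul,
      ENNReal.toReal_ofReal (by positivity), finrank_euclideanSpace_fin, measureReal_def]
  rw [measureReal_sdiff hsub hmeas (volume_cone_lt_top e).ne, hvol]
  have hle : volume.real (Metric.ball (0 : EuclideanSpace ℝ (Fin d)) (1 / 20))
      ≤ volume.real (cone e) := by
    rw [← Measure.addHaar_real_ball_center volume ((1 / 2 : ℝ) • e)]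
    exact measureReal_mono hball (volume_cone_lt_top e).ne
  have hld : l ^ d ≤ l := by
    simpa using pow_le_pow_of_le_one hl.le hl1 hd
  have h0 : 0 ≤ volume.real (cone e) := measureReal_nonneg
  nlinarith

/-- In the symmetrised formula only the points `y` with x - y in a thin shell of the cone about `e`
are kept. They lie in the ball about `x` but outside that about `x'`, have norm at most 7/8, and are
reflected to norm at least 9/8. The integrand there is at least the drop a - b, on a set of volume
at least a multiple of r' - r. -/
theorem ballAverage_slope (hd : 1 ≤ d) {u : EuclideanSpace ℝ (Fin d) → ℝ}
    (hu : IsRadialProfile u) :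
    ∃ c : ℝ, 0 < c ∧ ∀ (e : EuclideanSpace ℝ (Fin d)), ‖e‖ = 1 → ∀ r r' : ℝ, 7 / 8 ≤ r →
      r ≤ r' → r' ≤ 9 / 8 → c * (r' - r) ≤ ballAverage u (r • e) - ballAverage u (r' • e) := by
  obtain ⟨a, b, hab, ha, hb⟩ := hu.drop
  set v := volume.real (Metric.ball (0 : EuclideanSpace ℝ (Fin d)) (1 / 20))
  have hv : 0 < v := ENNReal.toReal_pos (Metric.measure_ball_pos volume _ (by norm_num)).ne'
    measure_ball_lt_top.ne
  refine ⟨(a - b) * v / 4, by have := sub_pos.2 hab; positivity,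
    fun e he r r' hr hrr hr' => ?_⟩
  rcases hrr.eq_or_lt with rfl | hlt
  · simp
  set x := r • e with hxdef
  set x' := r' • e with hxdef'
  have hxx : x' - x = (r' - r) • e := by rw [hxdef, hxdef', sub_smul]
  have hx : x ≠ x' := by
    intro h
    have h0 : ‖x' - x‖ = 0 := by rw [h, sub_self, norm_zero]
    rw [hxx, norm_smul, he, mul_one, Real.norm_eq_abs, abs_eq_zero] at h0
    linarith
  have hnx : ‖x‖ = r := by rw [hxdef, norm_smul, he, mul_one, Real.norm_of_nonneg (by linarith)]
  have hnx' : ‖x'‖ = r' := by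
    rw [hxdef', norm_smul, he, mul_one, Real.norm_of_nonneg (by linarith)]
  -- For ‖z‖ > l, moving z by (r' - r)e, at an angle of cosine at least 3/4, takes it out of the
  -- unit ball; the shell volume stays proportional to r' - r.
  set l := 1 - (r' - r) / 2 with hl
  set P := (fun y => x - y) ⁻¹' (cone e \ l • cone e) with hP
  have hZ : MeasurableSet (cone e \ l • cone e) :=
    (isClosed_cone e).measurableSet.diff ((isClosed_cone e).measurableSet.const_smul₀ l)
  have hmp : MeasurePreserving (fun y => x - y) volume volume :=
    Measure.measurePreserving_sub_left volume x
  have hPm : MeasurableSet P := hmp.measurable hZ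
  have hPv : volume.real P = volume.real (cone e \ l • cone e) :=
    hmp.measureReal_preimage hZ.nullMeasurableSet
  have hPf : volume P < ∞ := by
    rw [hP, hmp.measure_preimage hZ.nullMeasurableSet]
    exact (measure_mono Set.sdiff_subset).trans_lt (volume_cone_lt_top e)
  have hvol := volume_real_cone_diff_ge hd he (l := l) (by rw [hl]; linarith) (by rw [hl]; linarith)
  have hpt : ∀ y, P.indicator (fun _ => a - b) y
      ≤ ((Metric.closedBall x 1).indicator (fun _ => (1 : ℝ)) y
          - (Metric.closedBall x' 1).indicator (fun _ => (1 : ℝ)) y)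
          * (u y - u (bisectorReflection x x' y)) := by
    intro y
    by_cases hy : y ∈ P
    swap
    · rw [Set.indicator_of_notMem hy]
      exact ballAverage_integrand_nonneg hu.anti hx (by rw [hnx, hnx']; exact hrr) y
    rw [Set.indicator_of_mem hy]
    obtain ⟨⟨hz1, hz2⟩, hz3⟩ := hy
    rw [smul_cone (by rw [hl]; linarith)] at hz3
    set z := x - y with hz
    have hzl : l < ‖z‖ := by
      by_contra hcon
      exact hz3 ⟨not_lt.1 hcon, hz2⟩
    have hyz : y = x - z := by rw [hz]; abel
    have hze : 3 / 4 * (7 / 8 : ℝ) ≤ inner ℝ z e := by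
      have : 7 / 8 ≤ ‖z‖ := by linarith
      linarith
    have hin : y ∈ Metric.closedBall x 1 := by
      rw [Metric.mem_closedBall, dist_comm, dist_eq_norm]; exact hz1
    have hout : y ∉ Metric.closedBall x' 1 := by
      rw [Metric.mem_closedBall, dist_comm, dist_eq_norm, not_le]
      have e1 : x' - y = z + (r' - r) • e := by rw [hz, ← hxx]; abel
      have e2 : ‖x' - y‖ ^ 2 = ‖z‖ ^ 2 + 2 * ((r' - r) * inner ℝ z e) + (r' - r) ^ 2 := by
        rw [e1, norm_add_sq_real, inner_smul_right, norm_smul, he, mul_one, Real.norm_eq_abs,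
          sq_abs]
      have e3 : 1 < ‖x' - y‖ ^ 2 := by
        rw [e2]
        nlinarith
      exact (one_lt_sq_iff₀ (norm_nonneg _)).1 e3
    have hy78 : ‖y‖ ≤ 7 / 8 := by
      have e1 : y = (r - 1) • e - (z - e) := by rw [hyz, hxdef]; module
      have e2 : ‖(r - 1) • e‖ ≤ 1 / 8 := by
        rw [norm_smul, he, mul_one, Real.norm_eq_abs, abs_le]; constructor <;> linarith
      have e3 : ‖z - e‖ ^ 2 ≤ (3 / 4) ^ 2 := by
        rw [norm_sub_sq_real, he]
        nlinarith
      have e4 : ‖z - e‖ ≤ 3 / 4 := by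
        simpa only [abs_norm] using abs_le_of_sq_le_sq e3 (by norm_num)
      rw [e1]
      exact (norm_sub_le _ _).trans (by linarith)
    have hσ : 9 / 8 ≤ ‖bisectorReflection x x' y‖ := by
      have e1 := inner_sub_midpoint x x' y
      have e2 : inner ℝ (bisectorReflection x x' y) e = r' + inner ℝ z e := by
        rw [bisectorReflection_apply, hxx, norm_smul, he, mul_one, Real.norm_eq_abs, sq_abs,
          inner_sub_left, real_inner_smul_left, real_inner_smul_left, real_inner_smul_left,
          real_inner_self_eq_norm_sq, he, inner_sub_right, hyz, midpoint_eq_smul_add, hxdef,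
          hxdef', invOf_eq_inv, ← add_smul, smul_smul, inner_sub_right, inner_sub_left,
          real_inner_smul_left, inner_smul_right, inner_smul_right, real_inner_self_eq_norm_sq, he,
          real_inner_comm e z]
        have : r' - r ≠ 0 := by linarith
        field_simp
        ring
      have e3 := abs_real_inner_le_norm (bisectorReflection x x' y) e
      rw [he, mul_one, e2] at e3
      have := (abs_le.1 e3).2
      linarith
    rw [Set.indicator_of_mem hin, Set.indicator_of_notMem hout]
    linarith [ha y hy78, hb _ hσ]
  have hint : Integrable (P.indicator fun _ => a - b) :=
    (integrable_indicator_iff hPm).2 (integrableOn_const hPf.ne)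
  have huσ : Integrable (fun y => u (bisectorReflection x x' y)) :=
    (measurePreserving_bisectorReflection x x').integrable_comp_of_integrable hu.integrable
  have hB : ∀ z : EuclideanSpace ℝ (Fin d),
      Measurable ((Metric.closedBall z 1).indicator (fun _ => (1 : ℝ))) :=
    fun z => measurable_const.indicator Metric.isClosed_closedBall.measurableSet
  have hint2 : Integrable fun y => ((Metric.closedBall x 1).indicator (fun _ => (1 : ℝ)) y
          - (Metric.closedBall x' 1).indicator (fun _ => (1 : ℝ)) y)
          * (u y - u (bisectorReflection x x' y)) := by
    refine (hu.integrable.sub huσ).bdd_mul ((hB x).sub (hB x')).aestronglyMeasurable (c := 1)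
      (ae_of_all _ fun y => ?_)
    by_cases h1 : y ∈ Metric.closedBall x 1 <;> by_cases h2 : y ∈ Metric.closedBall x' 1 <;>
      simp [h1, h2]
  have hfin := integral_mono hint hint2 hpt
  rw [← ballAverage_sub_ballAverage hu.integrable hx, integral_indicator_const _ hPm,
    smul_eq_mul, hPv] at hfin
  have : 1 - l = (r' - r) / 2 := by rw [hl]; ring
  rw [this] at hvol
  nlinarith [mul_le_mul_of_nonneg_right hvol (sub_pos.2 hab).le]

end BallAverage

/-! ### Convolution powers of the ball. -/

section RadialProfile

variable {d : ℕ}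

theorem isRadialProfile_indicator :
    IsRadialProfile ((unitBall d).indicator fun _ => (1 : ℝ)) where
  measurable := measurable_const.indicator measurableSet_unitBall
  integrable := (integrable_indicator_iff measurableSet_unitBall).2
    (integrableOn_const volume_unitBall_lt_top.ne)
  nonneg := Set.indicator_nonneg fun _ _ => zero_le_one
  bounded := ⟨1, fun x => Set.indicator_le_self' (fun _ _ => zero_le_one) x⟩
  anti x y h := by
    by_cases hy : y ∈ unitBall d
    · have hx : x ∈ unitBall d :=
        mem_closedBall_zero_iff.2 (h.trans (mem_closedBall_zero_iff.1 hy))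
      rw [Set.indicator_of_mem hx, Set.indicator_of_mem hy]
    · rw [Set.indicator_of_notMem hy]
      exact Set.indicator_nonneg (fun _ _ => zero_le_one) x
  drop := by
    refine ⟨1, 0, one_pos, fun x hx => ?_, fun x hx => ?_⟩
    · have hx' : x ∈ unitBall d := mem_closedBall_zero_iff.2 (by linarith)
      rw [Set.indicator_of_mem hx']
    · rw [Set.indicator_of_notMem]
      intro h
      linarith [mem_closedBall_zero_iff.1 h]

theorem exists_norm_eq_one (hd : 1 ≤ d) : ∃ e : EuclideanSpace ℝ (Fin d), ‖e‖ = 1 :=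
  ⟨EuclideanSpace.single ⟨0, hd⟩ 1, by simp⟩

theorem IsRadialProfile.continuous_ballAverage {u : EuclideanSpace ℝ (Fin d) → ℝ}
    (hu : IsRadialProfile u) : Continuous (ballAverage u) := by
  obtain ⟨C, hC⟩ := hu.bounded
  exact _root_.continuous_ballAverage hu.integrable (C := C) fun x => by
    rw [abs_of_nonneg (hu.nonneg x)]; exact hC x

/-- Stability of the class under averaging is what drives the induction over convolution powers. The
drop of the new function comes from the slope between radii 7/8 and 9/8. -/
theorem IsRadialProfile.ballAverage (hd : 1 ≤ d) {u : EuclideanSpace ℝ (Fin d) → ℝ}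
    (hu : IsRadialProfile u) : IsRadialProfile (ballAverage u) where
  measurable := hu.continuous_ballAverage.measurable
  integrable := integrable_ballAverage hu.integrable
  nonneg x := integral_nonneg fun y => Set.indicator_nonneg (fun y _ => hu.nonneg y) y
  bounded := ⟨∫ y, u y, fun x => integral_mono
    (hu.integrable.indicator Metric.isClosed_closedBall.measurableSet) hu.integrable
    fun y => Set.indicator_le_self' (fun y _ => hu.nonneg y) y⟩
  anti := ballAverage_anti hu.integrable hu.anti
  drop := by
    obtain ⟨c, hc, hslope⟩ := ballAverage_slope hd hu
    obtain ⟨e, he⟩ := exists_norm_eq_one hd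
    have hne : ∀ r : ℝ, 0 ≤ r → ‖r • e‖ = r := fun r hr => by
      rw [norm_smul, he, mul_one, Real.norm_of_nonneg hr]
    refine ⟨_root_.ballAverage u ((7 / 8 : ℝ) • e), _root_.ballAverage u ((9 / 8 : ℝ) • e), ?_,
      fun x hx => ?_, fun x hx => ?_⟩
    · have := hslope e he (7 / 8) (9 / 8) le_rfl (by norm_num) le_rfl
      linarith
    · exact ballAverage_anti hu.integrable hu.anti _ _ (by rw [hne _ (by norm_num)]; exact hx)
    · exact ballAverage_anti hu.integrable hu.anti _ _ (by rw [hne _ (by norm_num)]; exact hx)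

theorem exists_profile_fourier_eq_pow (hd : 1 ≤ d) (n : ℕ) :
    ∃ u : EuclideanSpace ℝ (Fin d) → ℝ, IsRadialProfile u ∧
      ∀ ξ, 𝓕 (fun x => (u x : ℂ)) ξ = (ballFourier d ξ : ℂ) ^ (n + 1) := by
  induction n with
  | zero =>
    refine ⟨_, isRadialProfile_indicator, fun ξ => ?_⟩
    have h : (fun x => (((unitBall d).indicator (fun _ => (1 : ℝ)) x : ℝ) : ℂ))
        = ballIndicator d := by
      ext x
      by_cases hx : x ∈ unitBall d <;> simp [ballIndicator, hx]
    rw [zero_add, pow_one, ofReal_ballFourier, h]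
  | succ n ih =>
    obtain ⟨u, hu, hfu⟩ := ih
    refine ⟨_, hu.ballAverage hd, fun ξ => ?_⟩
    rw [fourier_ballAverage hu.integrable, hfu, pow_succ _ (n + 1)]

theorem integrable_ballFourier_pow {n : ℕ} (hn : 3 ≤ n) :
    Integrable fun ξ => (ballFourier d ξ : ℂ) ^ n := by
  obtain ⟨H, hH, hH'⟩ := exists_integrable_bound_weighted d n
  have hc : Continuous fun ξ => (ballFourier d ξ : ℂ) ^ n :=
    (Complex.continuous_ofReal.comp continuous_ballFourier).pow n
  refine hH.mono' hc.aestronglyMeasurable (ae_of_all _ fun ξ => ?_)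
  rw [norm_pow, Complex.norm_real, Real.norm_eq_abs, ← Real.rpow_natCast]
  refine le_trans ?_ (hH' n (by
    have : (3 : ℝ) ≤ n := by exact_mod_cast hn
    linarith) le_rfl ξ)
  have := norm_nonneg ξ
  have h0 : 0 ≤ |ballFourier d ξ| ^ (n : ℝ) := by positivity
  nlinarith

/-- The Fourier transform of a power of the ball's Fourier transform decreases strictly, at a linear
rate, across the unit sphere. -/
theorem exists_fourier_ballFourier_pow (hd : 1 ≤ d) {n : ℕ} (hn : 3 ≤ n) :
    ∃ u : EuclideanSpace ℝ (Fin d) → ℝ,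
      (∀ x, 𝓕 (fun ξ => (ballFourier d ξ : ℂ) ^ n) x = u x) ∧ (∀ x, 0 ≤ u x) ∧
      (∀ x y, ‖x‖ ≤ ‖y‖ → u y ≤ u x) ∧
      ∃ c : ℝ, 0 < c ∧ ∀ (e : EuclideanSpace ℝ (Fin d)), ‖e‖ = 1 → ∀ r r' : ℝ, 7 / 8 ≤ r →
        r ≤ r' → r' ≤ 9 / 8 → c * (r' - r) ≤ u (r • e) - u (r' • e) := by
  -- The last factor is kept aside: the profile with transform φ^{m+1} is averaged once more, and
  -- that averaging supplies both continuity, for Fourier inversion, and the slope.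
  obtain ⟨m, rfl⟩ : ∃ m, n = m + 1 + 1 := ⟨n - 2, by omega⟩
  obtain ⟨u, hu, hfu⟩ := exists_profile_fourier_eq_pow hd m
  have hv := hu.ballAverage hd
  have hF : 𝓕 (fun x => (ballAverage u x : ℂ)) = fun ξ => (ballFourier d ξ : ℂ) ^ (m + 1 + 1) := by
    ext ξ
    rw [fourier_ballAverage hu.integrable, hfu, pow_succ _ (m + 1)]
  have hinv : 𝓕⁻ (𝓕 (fun x => (ballAverage u x : ℂ))) = fun x => (ballAverage u x : ℂ) := by
    refine Continuous.fourierInv_fourier_eq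
      (Complex.continuous_ofReal.comp hu.continuous_ballAverage) hv.integrable.ofReal ?_
    rw [hF]
    exact integrable_ballFourier_pow hn
  refine ⟨ballAverage u, fun x => ?_, hv.nonneg, hv.anti, ballAverage_slope hd hu⟩
  have h1 := congrFun hinv (-x)
  rw [Real.fourierInv_eq_fourier_neg, neg_neg, hF] at h1
  rw [h1]
  congr 1
  exact le_antisymm (hv.anti _ _ (by rw [norm_neg])) (hv.anti _ _ (by rw [norm_neg]))

end RadialProfile

/-! ### Lipschitz bound for Fourier transforms with an integrable first moment. -/

section FourierLipschitz

variable {V : Type*} [NormedAddCommGroup V] [InnerProductSpace ℝ V] [MeasurableSpace V]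
  [BorelSpace V] [FiniteDimensional ℝ V]

theorem norm_fourierChar_sub_le (a b : ℝ) :
    ‖(Real.fourierChar a : ℂ) - Real.fourierChar b‖ ≤ 2 * Real.pi * |a - b| := by
  have h1 : (Real.fourierChar a : ℂ) - Real.fourierChar b
      = Real.fourierChar b * ((Real.fourierChar (a - b) : ℂ) - 1) := by
    rw [mul_sub, mul_one, ← Circle.coe_mul, ← AddChar.map_add_eq_mul, add_sub_cancel]
  rw [h1, norm_mul, Circle.norm_coe, one_mul, Real.fourierChar_apply, mul_comm _ Complex.I]
  refine (Real.norm_exp_I_mul_ofReal_sub_one_le (x := 2 * Real.pi * (a - b))).trans ?_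
  rw [Real.norm_eq_abs, abs_mul, abs_of_pos Real.two_pi_pos]

theorem norm_fourier_sub_le {f : V → ℂ} (hf : Integrable f)
    (hf1 : Integrable fun x => ‖x‖ * ‖f x‖) (ξ η : V) :
    ‖𝓕 f ξ - 𝓕 f η‖ ≤ (∫ x, 2 * Real.pi * (‖x‖ * ‖f x‖)) * ‖ξ - η‖ := by
  rw [Real.fourier_eq, Real.fourier_eq, ← integral_sub
    ((Real.fourierIntegral_convergent_iff ξ).2 hf) ((Real.fourierIntegral_convergent_iff η).2 hf),
    ← integral_mul_const]
  refine norm_integral_le_of_norm_le ((hf1.const_mul _).mul_const _) (ae_of_all _ fun x => ?_)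
  rw [Circle.smul_def, Circle.smul_def, smul_eq_mul, smul_eq_mul, ← sub_mul, norm_mul]
  have h1 := norm_fourierChar_sub_le (-inner ℝ x ξ) (-inner ℝ x η)
  have h2 : |(-inner ℝ x ξ) - (-inner ℝ x η)| ≤ ‖x‖ * ‖ξ - η‖ := by
    have : (-inner ℝ x ξ) - (-inner ℝ x η) = -inner ℝ x (ξ - η) := by rw [inner_sub_right]; ring
    rw [this, abs_neg]
    exact abs_real_inner_le_norm _ _
  calc _ ≤ (2 * Real.pi * (‖x‖ * ‖ξ - η‖)) * ‖f x‖ := by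
        gcongr
        refine h1.trans ?_
        have := Real.pi_pos
        gcongr
    _ = _ := by ring

end FourierLipschitz

/-! ### The first-variation kernel and its level at the unit sphere. -/

section Kernel

variable {d : ℕ}

/-- The derivative `|φ| ^ (q - 2) φ` of `|φ| ^ q / q` at the ball's Fourier transform `φ`. -/
noncomputable def powerSymbol (d : ℕ) (q : ℝ) (ξ : EuclideanSpace ℝ (Fin d)) : ℝ :=
  |ballFourier d ξ| ^ (q - 2) * ballFourier d ξ

theorem abs_powerSymbol {q : ℝ} (hq : 2 ≤ q) (ξ : EuclideanSpace ℝ (Fin d)) :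
    |powerSymbol d q ξ| = |ballFourier d ξ| ^ (q - 1) := by
  rw [powerSymbol, abs_mul, abs_of_nonneg (by positivity)]
  nth_rewrite 2 [← Real.rpow_one |ballFourier d ξ|]
  rw [← Real.rpow_add_of_nonneg (abs_nonneg _) (by linarith) zero_le_one]
  congr 1
  ring

theorem continuous_powerSymbol {q : ℝ} (hq : 2 ≤ q) : Continuous (powerSymbol d q) :=
  ((continuous_ballFourier.abs).rpow_const fun _ => Or.inr (by linarith)).mul continuous_ballFourier

theorem integrable_weighted_powerSymbol {q : ℝ} (hq : 7 / 2 ≤ q) :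
    Integrable fun ξ : EuclideanSpace ℝ (Fin d) => (1 + ‖ξ‖) * |powerSymbol d q ξ| := by
  obtain ⟨H, hH, hH'⟩ := exists_integrable_bound_weighted d (q - 1)
  have hc := continuous_powerSymbol (d := d) (q := q) (by linarith)
  refine hH.mono' (Continuous.aestronglyMeasurable (by fun_prop)) (ae_of_all _ fun ξ => ?_)
  rw [Real.norm_of_nonneg (by positivity), abs_powerSymbol (by linarith)]
  exact hH' (q - 1) (by linarith) le_rfl ξ

theorem integrable_powerSymbol {q : ℝ} (hq : 7 / 2 ≤ q) :
    Integrable fun ξ => (powerSymbol d q ξ : ℂ) := by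
  refine (integrable_weighted_powerSymbol hq).mono' (Complex.continuous_ofReal.comp
    (continuous_powerSymbol (by linarith))).aestronglyMeasurable (ae_of_all _ fun ξ => ?_)
  rw [Complex.norm_real, Real.norm_eq_abs]
  nlinarith [norm_nonneg ξ, abs_nonneg (powerSymbol d q ξ)]

theorem fourier_powerSymbol_isometry (q : ℝ)
    (A : EuclideanSpace ℝ (Fin d) ≃ₗᵢ[ℝ] EuclideanSpace ℝ (Fin d)) (x) :
    𝓕 (fun ξ => (powerSymbol d q ξ : ℂ)) (A x) = 𝓕 (fun ξ => (powerSymbol d q ξ : ℂ)) x := by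
  rw [← Real.fourier_comp_linearIsometry]
  have : (fun ξ => (powerSymbol d q ξ : ℂ)) ∘ A = fun ξ => (powerSymbol d q ξ : ℂ) := by
    ext ξ
    simp only [Function.comp_apply, powerSymbol, ballFourier_isometry]
  rw [this]

theorem ofReal_re_fourier_powerSymbol (q : ℝ) (x : EuclideanSpace ℝ (Fin d)) :
    ((𝓕 (fun ξ => (powerSymbol d q ξ : ℂ)) x).re : ℂ)
      = 𝓕 (fun ξ => (powerSymbol d q ξ : ℂ)) x := by
  refine Complex.conj_eq_iff_re.1 ?_
  rw [conj_fourier_apply]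
  simp only [Complex.conj_ofReal]
  exact fourier_powerSymbol_isometry q (LinearIsometryEquiv.neg ℝ) x

theorem fourier_powerSymbol_radial (q : ℝ) {x y : EuclideanSpace ℝ (Fin d)} (h : ‖x‖ = ‖y‖) :
    𝓕 (fun ξ => (powerSymbol d q ξ : ℂ)) x = 𝓕 (fun ξ => (powerSymbol d q ξ : ℂ)) y := by
  rw [← Submodule.reflection_sub h]
  exact (fourier_powerSymbol_isometry q _ x).symm

theorem powerSymbol_natCast {n : ℕ} (hn : Even n) (hn2 : 2 ≤ n) (ξ : EuclideanSpace ℝ (Fin d)) :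
    powerSymbol d n ξ = ballFourier d ξ ^ (n - 1) := by
  have h1 : ((n : ℝ) - 2) = ((n - 2 : ℕ) : ℝ) := by rw [Nat.cast_sub hn2]; norm_num
  have h2 : Even (n - 2) := (Nat.even_sub hn2).2 (by simp [hn])
  rw [powerSymbol, h1, Real.rpow_natCast, h2.pow_abs, ← pow_succ]
  congr 1
  omega

/-- Zeros of φ are treated apart because a real power with base 0 is not continuous in the exponent;
there the factor φ makes the symbol vanish for every q. -/
theorem tendsto_powerSymbol (q₀ : ℝ) (ξ : EuclideanSpace ℝ (Fin d)) :
    Filter.Tendsto (fun q => powerSymbol d q ξ) (nhds q₀) (nhds (powerSymbol d q₀ ξ)) := by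
  rcases eq_or_ne (ballFourier d ξ) 0 with h | h
  · simp only [powerSymbol, h, mul_zero]
    exact tendsto_const_nhds
  · have hc : Continuous fun q : ℝ => powerSymbol d q ξ :=
      (continuous_const.rpow (continuous_id.sub continuous_const)
        fun _ => Or.inl (abs_ne_zero.2 h)).mul continuous_const
    exact hc.tendsto q₀

/-- The weight 1 + 2π‖ξ‖ makes this single integral bound both the sup norm and the Lipschitz
constant of the difference of the kernels. The limit is by dominated convergence. -/
theorem tendsto_integral_powerSymbol_sub (d : ℕ) {q₀ : ℝ} (hq₀ : 4 ≤ q₀) :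
    Filter.Tendsto (fun q => ∫ ξ : EuclideanSpace ℝ (Fin d),
        (1 + 2 * Real.pi * ‖ξ‖) * |powerSymbol d q ξ - powerSymbol d q₀ ξ|)
      (nhds q₀) (nhds 0) := by
  obtain ⟨H, hH, hH'⟩ := exists_integrable_bound_weighted d q₀
  have h0 : ∫ ξ : EuclideanSpace ℝ (Fin d), (1 + 2 * Real.pi * ‖ξ‖)
      * |powerSymbol d q₀ ξ - powerSymbol d q₀ ξ| = 0 := by simp
  rw [← h0]
  have hnear : ∀ᶠ q : ℝ in nhds q₀, q ∈ Set.Icc (7 / 2) (q₀ + 1) :=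
    Icc_mem_nhds (by linarith) (by linarith)
  refine tendsto_integral_filter_of_dominated_convergence
    (fun ξ => (1 + 2 * Real.pi) * (2 * H ξ)) ?_ ?_ ((hH.const_mul 2).const_mul _) ?_
  · filter_upwards [hnear] with q hq
    have h1 := continuous_powerSymbol (d := d) (q := q) (by linarith [hq.1])
    have h2 := continuous_powerSymbol (d := d) (q := q₀) (by linarith)
    exact Continuous.aestronglyMeasurable (by fun_prop)
  · filter_upwards [hnear] with q hq
    refine ae_of_all _ fun ξ => ?_
    have hp := Real.pi_pos
    have hn := norm_nonneg ξ
    rw [Real.norm_of_nonneg (by positivity)]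
    have h1 := hH' (q - 1) (by linarith [hq.1]) (by linarith [hq.2]) ξ
    have h2 := hH' (q₀ - 1) (by linarith) (by linarith) ξ
    rw [← abs_powerSymbol (by linarith [hq.1])] at h1
    rw [← abs_powerSymbol (by linarith)] at h2
    calc (1 + 2 * Real.pi * ‖ξ‖) * |powerSymbol d q ξ - powerSymbol d q₀ ξ|
        ≤ ((1 + 2 * Real.pi) * (1 + ‖ξ‖)) * (|powerSymbol d q ξ| + |powerSymbol d q₀ ξ|) := by
          gcongr
          · nlinarith
          · exact abs_sub _ _
      _ ≤ _ := by
          rw [mul_assoc]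
          refine mul_le_mul_of_nonneg_left ?_ (by positivity)
          linarith
  · refine ae_of_all _ fun ξ => ?_
    exact (((tendsto_powerSymbol q₀ ξ).sub_const _).abs).const_mul _

/-- For exponents near an even integer, the kernel `𝓕 (|φ| ^ (q - 2) φ)` crosses a positive level
exactly at the unit sphere. -/
theorem exists_kernel_level (hd : 1 ≤ d) {n : ℕ} (hn : Even n) (hn4 : 4 ≤ n) :
    ∃ ρ κ₀ A : ℝ, 0 < ρ ∧ ρ ≤ 1 / 2 ∧ 0 < κ₀ ∧ 0 < A ∧ ∀ q : ℝ, |q - n| ≤ ρ →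
      ∃ (K : EuclideanSpace ℝ (Fin d) → ℝ) (κ : ℝ), κ₀ ≤ κ ∧
        (∀ x, 𝓕 (fun ξ => (powerSymbol d q ξ : ℂ)) x = K x) ∧ (∀ x, |K x| ≤ A) ∧
        (∀ x ∈ unitBall d, κ ≤ K x) ∧ (∀ x ∉ unitBall d, K x ≤ κ) := by
  -- For even n the symbol is φ^{n-1}, and n ≥ 4 gives the three factors required.
  obtain ⟨u, hu, hu0, hanti, c, hc, hslope⟩ :=
    exists_fourier_ballFourier_pow hd (n := n - 1) (by omega)
  have hn4' : (4 : ℝ) ≤ n := by exact_mod_cast hn4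
  -- The function `u` drops by at least c/8 over a radial distance of 1/8. A perturbation θ < c/16
  -- costs at most 2θ < c/8, and also leaves a level of at least c/8 - c/16 = c/16 at the sphere.
  have hev := (tendsto_integral_powerSymbol_sub d hn4').eventually
    (gt_mem_nhds (show (0 : ℝ) < c / 16 by positivity))
  obtain ⟨ρ, hρ, hρ'⟩ := Metric.eventually_nhds_iff.1 hev
  refine ⟨min (ρ / 2) (1 / 2), c / 16, u 0 + c, by positivity, min_le_right _ _, by positivity,
    by have := hu0 0; positivity, fun q hq => ?_⟩
  have hqρ : dist q n < ρ := by
    rw [Real.dist_eq]; have := min_le_left (ρ / 2) (1 / 2); linarith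
  have hq72 : 7 / 2 ≤ q := by
    have := (abs_le.1 (hq.trans (min_le_right _ _))).1; linarith
  set θ := ∫ ξ : EuclideanSpace ℝ (Fin d),
        (1 + 2 * Real.pi * ‖ξ‖) * |powerSymbol d q ξ - powerSymbol d n ξ| with hθ
  have hθc : θ < c / 16 := hρ' hqρ
  set K : EuclideanSpace ℝ (Fin d) → ℝ :=
    fun x => (𝓕 (fun ξ => (powerSymbol d q ξ : ℂ)) x).re with hK
  have hKc : ∀ x, 𝓕 (fun ξ => (powerSymbol d q ξ : ℂ)) x = K x :=
    fun x => (ofReal_re_fourier_powerSymbol q x).symm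
  have hKr : ∀ x y, ‖x‖ = ‖y‖ → K x = K y := fun x y h => by
    simp only [hK, fourier_powerSymbol_radial q h]
  set D : EuclideanSpace ℝ (Fin d) → ℂ :=
    (fun ξ => (powerSymbol d q ξ : ℂ)) - fun ξ => (powerSymbol d n ξ : ℂ) with hD
  have hDi : Integrable D := (integrable_powerSymbol hq72).sub (integrable_powerSymbol (by linarith))
  have hDF : ∀ x, 𝓕 D x = ((K x - u x : ℝ) : ℂ) := fun x => by
    rw [hD, fourier_sub_apply (integrable_powerSymbol hq72) (integrable_powerSymbol (by linarith)),
      hKc, Complex.ofReal_sub, ← hu]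
    simp only [powerSymbol_natCast hn (by omega), Complex.ofReal_pow]
  have hDn : ∀ ξ, ‖D ξ‖ = |powerSymbol d q ξ - powerSymbol d n ξ| := fun ξ => by
    rw [hD, Pi.sub_apply, ← Complex.ofReal_sub, Complex.norm_real, Real.norm_eq_abs]
  have hpi := Real.pi_pos
  have hDw : Integrable fun ξ => (1 + 2 * Real.pi * ‖ξ‖) * ‖D ξ‖ := by
    refine (((integrable_weighted_powerSymbol (d := d) hq72).add (integrable_weighted_powerSymbol
      (d := d) (q := n) (by linarith))).const_mul (1 + 2 * Real.pi)).mono'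
      ((by fun_prop : Continuous fun ξ : EuclideanSpace ℝ (Fin d) =>
        1 + 2 * Real.pi * ‖ξ‖).aestronglyMeasurable.mul hDi.norm.aestronglyMeasurable)
      (ae_of_all _ fun ξ => ?_)
    have hn := norm_nonneg ξ
    rw [Real.norm_of_nonneg (by positivity), hDn]
    calc (1 + 2 * Real.pi * ‖ξ‖) * |powerSymbol d q ξ - powerSymbol d n ξ|
        ≤ ((1 + 2 * Real.pi) * (1 + ‖ξ‖)) * (|powerSymbol d q ξ| + |powerSymbol d n ξ|) := by
          gcongr
          · nlinarith
          · exact abs_sub _ _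
      _ = (1 + 2 * Real.pi) * ((1 + ‖ξ‖) * |powerSymbol d q ξ|
          + (1 + ‖ξ‖) * |powerSymbol d n ξ|) := by ring
  have hDx : Integrable fun ξ => ‖ξ‖ * ‖D ξ‖ := by
    refine hDw.mono' (continuous_norm.aestronglyMeasurable.mul hDi.norm.aestronglyMeasurable)
      (ae_of_all _ fun ξ => ?_)
    rw [Real.norm_of_nonneg (by positivity)]
    refine mul_le_mul_of_nonneg_right ?_ (norm_nonneg _)
    nlinarith [norm_nonneg ξ, Real.pi_gt_three]
  have hθD : θ = ∫ ξ, (1 + 2 * Real.pi * ‖ξ‖) * ‖D ξ‖ := by simp only [hθ, hDn]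
  have hsup : ∀ x, |K x - u x| ≤ θ := fun x => by
    rw [← Real.norm_eq_abs, ← Complex.norm_real, ← hDF, hθD]
    refine (norm_fourier_le D x).trans (integral_mono hDi.norm hDw fun ξ => ?_)
    have : 0 ≤ 2 * Real.pi * ‖ξ‖ * ‖D ξ‖ := by positivity
    change ‖D ξ‖ ≤ (1 + 2 * Real.pi * ‖ξ‖) * ‖D ξ‖
    linarith
  have hlip : ∀ x y, |(K x - u x) - (K y - u y)| ≤ θ * ‖x - y‖ := fun x y => by
    rw [← Real.norm_eq_abs, ← Complex.norm_real, Complex.ofReal_sub, ← hDF, ← hDF, hθD]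
    refine (norm_fourier_sub_le hDi hDx x y).trans ?_
    refine mul_le_mul_of_nonneg_right (integral_mono (hDx.const_mul _) hDw fun ξ => ?_)
      (norm_nonneg _)
    change 2 * Real.pi * (‖ξ‖ * ‖D ξ‖) ≤ (1 + 2 * Real.pi * ‖ξ‖) * ‖D ξ‖
    have : 0 ≤ ‖D ξ‖ := norm_nonneg _
    linarith
  obtain ⟨e, he⟩ := exists_norm_eq_one hd
  have hne : ∀ r : ℝ, 0 ≤ r → ‖r • e‖ = r := fun r hr => by
    rw [norm_smul, he, mul_one, Real.norm_of_nonneg hr]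
  have hdist : ∀ r r' : ℝ, r ≤ r' → ‖r • e - r' • e‖ = r' - r := fun r r' h => by
    rw [← sub_smul, norm_smul, he, mul_one, Real.norm_eq_abs, abs_sub_comm,
      abs_of_nonneg (by linarith)]
  -- Within distance 1/8 of the sphere the slope c beats the Lipschitz constant θ of the
  -- perturbation; further away the accumulated drop c/8 beats its sup norm.
  have hin : ∀ r : ℝ, 0 ≤ r → r ≤ 1 → K ((1 : ℝ) • e) ≤ K (r • e) := fun r h0 h1 => by
    rcases le_or_gt (7 / 8) r with h | h
    · have a1 := hslope e he r 1 h h1 (by norm_num)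
      have a2 := (abs_le.1 (hlip (r • e) ((1 : ℝ) • e))).1
      rw [hdist r 1 h1] at a2
      nlinarith
    · have a1 := hslope e he (7 / 8) 1 le_rfl (by norm_num) (by norm_num)
      have a2 := hanti (r • e) ((7 / 8 : ℝ) • e)
        (by rw [hne _ h0, hne _ (by norm_num)]; exact h.le)
      have a3 := (abs_le.1 (hsup (r • e))).1
      have a4 := (abs_le.1 (hsup ((1 : ℝ) • e))).2
      linarith
  have hout : ∀ r : ℝ, 1 ≤ r → K (r • e) ≤ K ((1 : ℝ) • e) := fun r h1 => by
    rcases le_or_gt r (9 / 8) with h | h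
    · have a1 := hslope e he 1 r (by norm_num) h1 h
      have a2 := (abs_le.1 (hlip ((1 : ℝ) • e) (r • e))).1
      rw [hdist 1 r h1] at a2
      nlinarith
    · have a1 := hslope e he 1 (9 / 8) (by norm_num) (by norm_num) le_rfl
      have a2 := hanti ((9 / 8 : ℝ) • e) (r • e)
        (by rw [hne _ (by norm_num), hne _ (by linarith)]; exact h.le)
      have a3 := (abs_le.1 (hsup (r • e))).2
      have a4 := (abs_le.1 (hsup ((1 : ℝ) • e))).1
      linarith
  refine ⟨K, K ((1 : ℝ) • e), ?_, hKc, fun x => ?_, fun x hx => ?_, fun x hx => ?_⟩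
  · have a1 := hslope e he 1 (9 / 8) (by norm_num) (by norm_num) le_rfl
    have a2 := (abs_le.1 (hsup ((1 : ℝ) • e))).1
    have a3 := hu0 ((9 / 8 : ℝ) • e)
    linarith
  · have a1 := abs_le.1 (hsup x)
    have a2 := hanti 0 x (by simp)
    have a3 := hu0 x
    rw [abs_le]
    constructor <;> linarith [a1.1, a1.2]
  · rw [hKr x (‖x‖ • e) (hne _ (norm_nonneg x)).symm]
    exact hin _ (norm_nonneg x) (mem_closedBall_zero_iff.1 hx)
  · rw [hKr x (‖x‖ • e) (hne _ (norm_nonneg x)).symm]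
    exact hout _ (not_le.1 fun h => hx (mem_closedBall_zero_iff.2 h)).le

end Kernel

/-! ### L^q bounds for Fourier transforms by interpolating between the sup bound and Plancherel. -/

section LqExpansion

variable {V : Type*} [NormedAddCommGroup V] [InnerProductSpace ℝ V] [MeasurableSpace V]
  [BorelSpace V] [FiniteDimensional ℝ V]

theorem norm_fourier_rpow_le {f : V → ℂ} {q : ℝ} (hq : 2 ≤ q) (ξ : V) :
    ‖𝓕 f ξ‖ ^ q ≤ (∫ x, ‖f x‖) ^ (q - 2) * ‖𝓕 f ξ‖ ^ 2 := by
  calc ‖𝓕 f ξ‖ ^ q = ‖𝓕 f ξ‖ ^ (q - 2) * ‖𝓕 f ξ‖ ^ 2 := by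
        rw [← Real.rpow_natCast, ← Real.rpow_add_of_nonneg (norm_nonneg _) (by linarith)
          (by norm_num)]
        norm_num
    _ ≤ _ := by
        gcongr
        exact norm_fourier_le f ξ

theorem integrable_norm_fourier_rpow {f : V → ℂ} (hf : Integrable f) (hf2 : MemLp f 2) {q : ℝ}
    (hq : 2 ≤ q) : Integrable fun ξ => ‖𝓕 f ξ‖ ^ q := by
  refine (((memLp_fourier_two hf hf2).integrable_norm_pow two_ne_zero).const_mul
    ((∫ x, ‖f x‖) ^ (q - 2))).mono' ?_ (ae_of_all _ fun ξ => ?_)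
  · exact ((continuous_fourier hf).norm.rpow_const fun _ => Or.inr (by linarith)).aestronglyMeasurable
  · rw [Real.norm_of_nonneg (by positivity)]
    exact norm_fourier_rpow_le hq ξ

theorem integral_norm_fourier_rpow_le {f : V → ℂ} (hf : Integrable f) (hf2 : MemLp f 2) {q : ℝ}
    (hq : 2 ≤ q) :
    ∫ ξ, ‖𝓕 f ξ‖ ^ q ≤ (∫ x, ‖f x‖) ^ (q - 2) * ∫ x, ‖f x‖ ^ 2 := by
  rw [← integral_norm_fourier_sq hf hf2, ← integral_const_mul]
  exact integral_mono (integrable_norm_fourier_rpow hf hf2 hq)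
    (((memLp_fourier_two hf hf2).integrable_norm_pow two_ne_zero).const_mul _)
    fun ξ => norm_fourier_rpow_le hq ξ

theorem memLp_fourier_rpow {f : V → ℂ} (hf : Integrable f) (hf2 : MemLp f 2) {q : ℝ}
    (hq : 2 ≤ q) : MemLp (𝓕 f) (ENNReal.ofReal q) volume := by
  rw [← integrable_norm_rpow_iff (continuous_fourier hf).aestronglyMeasurable
    (by simp; linarith) ENNReal.ofReal_ne_top, ENNReal.toReal_ofReal (by linarith)]
  exact integrable_norm_fourier_rpow hf hf2 hq

end LqExpansion

/-! ### Expansion of the functional at the ball. -/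

section BallExpansion

variable {d : ℕ}

theorem fourierLqPow_eq_integral {f : EuclideanSpace ℝ (Fin d) → ℂ} (hf : Integrable f)
    (hf2 : MemLp f 2) {q : ℝ} (hq : 2 ≤ q) : fourierLqPow q f = ∫ ξ, ‖𝓕 f ξ‖ ^ q := by
  have hq0 : 0 < q := by linarith
  have h0 : 0 ≤ ∫ ξ, ‖𝓕 f ξ‖ ^ q := by positivity
  rw [fourierLqPow, (memLp_fourier_rpow hf hf2 hq).eLpNorm_eq_integral_rpow_norm
    (by simpa using hq0) ENNReal.ofReal_ne_top, ENNReal.toReal_ofReal hq0.le,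
    ENNReal.toReal_ofReal (by positivity), ← Real.rpow_mul h0, inv_mul_cancel₀ hq0.ne',
    Real.rpow_one]

/-- Second-order expansion of `‖F̂‖_q^q` around the indicator function of the ball. -/
theorem exists_fourierLqPow_add_le (d : ℕ) (P : ℝ) :
    ∃ ρ C : ℝ, 0 < ρ ∧ ρ ≤ 1 / 2 ∧ 0 < C ∧ ∀ q : ℝ, 4 - ρ ≤ q → q ≤ P →
      ∀ K : EuclideanSpace ℝ (Fin d) → ℝ,
      (∀ x, 𝓕 (fun ξ => (powerSymbol d q ξ : ℂ)) x = K x) →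
      ∀ h : EuclideanSpace ℝ (Fin d) → ℂ, Integrable h → MemLp h 2 →
        fourierLqPow q (ballIndicator d + h) ≤ fourierLqPow q (ballIndicator d)
          + q * (∫ x, K x * (h x).re)
          + C * ((∫ x, ‖h x‖) ^ 2 + (∫ x, ‖h x‖) ^ (q - 2) * ∫ x, ‖h x‖ ^ 2) := by
  obtain ⟨ρ, hρ0, hρ1, hbound⟩ := exists_integrable_bound_subquadratic d
  obtain ⟨H, hH, hH'⟩ := hbound P
  obtain ⟨C, hC, hpt⟩ := exists_norm_add_rpow_le P
  refine ⟨ρ, C * (1 + |∫ ξ, H ξ|), hρ0, hρ1, by positivity, ?_⟩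
  intro q hq hqP K hK h hh hh2
  have hq2 : 2 ≤ q := by linarith
  have hB := integrable_ballIndicator (d := d)
  have hB2 := memLp_ballIndicator (d := d) 2
  rw [fourierLqPow_eq_integral (hB.add hh) (hB2.add hh2) hq2, fourierLqPow_eq_integral hB hB2 hq2]
  simp only [fourier_add_apply hB hh, ← ofReal_ballFourier, Complex.norm_real, Real.norm_eq_abs]
  set n1 := ∫ x, ‖h x‖ with hn1
  have hn10 : 0 ≤ n1 := by positivity
  have i0 : Integrable fun ξ => ‖(ballFourier d ξ : ℂ) + 𝓕 h ξ‖ ^ q := by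
    have := integrable_norm_fourier_rpow (hB.add hh) (hB2.add hh2) hq2
    simpa only [fourier_add_apply hB hh, ← ofReal_ballFourier] using this
  have i1 : Integrable fun ξ => |ballFourier d ξ| ^ q := by
    simpa only [norm_fourier_ballIndicator] using integrable_norm_fourier_rpow hB hB2 hq2
  have hG := integrable_powerSymbol (d := d) (q := q) (by linarith)
  have hmulc : Integrable fun ξ => 𝓕 h ξ * (powerSymbol d q ξ : ℂ) :=
    hG.bdd_mul (continuous_fourier hh).aestronglyMeasurable
      (ae_of_all _ fun ξ => norm_fourier_le h ξ)
  have hre : ∀ ξ, (𝓕 h ξ * (powerSymbol d q ξ : ℂ)).re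
      = |ballFourier d ξ| ^ (q - 2) * ballFourier d ξ * (𝓕 h ξ).re := fun ξ => by
    rw [Complex.re_mul_ofReal, mul_comm, powerSymbol]
  have i2 : Integrable fun ξ => |ballFourier d ξ| ^ (q - 2) * ballFourier d ξ * (𝓕 h ξ).re := by
    simpa only [RCLike.re_eq_complex_re, hre] using hmulc.re
  -- The multiplication formula transfers the Fourier transform from `h` to the symbol, turning the
  -- linear term into a pairing with K.
  have e2 : ∫ ξ, |ballFourier d ξ| ^ (q - 2) * ballFourier d ξ * (𝓕 h ξ).re
      = ∫ x, K x * (h x).re := by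
    have hxi : Integrable fun x => h x * (K x : ℂ) := by
      simp only [← hK]
      simp only [mul_comm (h _)]
      exact hh.bdd_mul (continuous_fourier hG).aestronglyMeasurable
        (ae_of_all _ fun x => norm_fourier_le _ x)
    have h1 := congrArg Complex.re (integral_fourier_mul_eq hh hG)
    simp only [hK] at h1
    have h2 := integral_re hmulc
    have h3 := integral_re hxi
    simp only [RCLike.re_eq_complex_re, hre] at h2 h3
    rw [h2, h1, ← h3]
    simp only [Complex.re_mul_ofReal, mul_comm]
  -- The quadratic term needs only |ĥ| ≤ ‖h‖₁ and the integrability of |φ|^{q-2}; here q - 2 ≥ 2 - ρ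
  -- enters.
  have hbd : ∀ ξ, |ballFourier d ξ| ^ (q - 2) * ‖𝓕 h ξ‖ ^ 2 ≤ n1 ^ 2 * H ξ := fun ξ => by
    rw [mul_comm (n1 ^ 2)]
    have h1 := hH' (q - 2) (by linarith) (by linarith) ξ
    have h2 : 0 ≤ |ballFourier d ξ| ^ (q - 2) := by positivity
    have h3 := norm_fourier_le h ξ
    gcongr
    exact h2.trans h1
  have i3 : Integrable fun ξ => |ballFourier d ξ| ^ (q - 2) * ‖𝓕 h ξ‖ ^ 2 := by
    have hc : Continuous fun ξ => |ballFourier d ξ| ^ (q - 2) * ‖𝓕 h ξ‖ ^ 2 :=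
      (continuous_ballFourier.abs.rpow_const fun _ => Or.inr (by linarith)).mul
        ((continuous_fourier hh).norm.pow 2)
    refine (hH.const_mul (n1 ^ 2)).mono' hc.aestronglyMeasurable (ae_of_all _ fun ξ => ?_)
    rw [Real.norm_of_nonneg (by positivity)]
    exact hbd ξ
  have e3 : ∫ ξ, |ballFourier d ξ| ^ (q - 2) * ‖𝓕 h ξ‖ ^ 2 ≤ n1 ^ 2 * |∫ ξ, H ξ| := by
    refine (integral_mono i3 (hH.const_mul _) hbd).trans ?_
    rw [integral_const_mul]
    gcongr
    exact le_abs_self _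
  have i4 := integrable_norm_fourier_rpow hh hh2 hq2
  have e4 := integral_norm_fourier_rpow_le hh hh2 hq2
  have hmain := integral_mono i0 ((i1.add (i2.const_mul q)).add ((i3.add i4).const_mul C))
    fun ξ => hpt q hq2 hqP (ballFourier d ξ) (𝓕 h ξ)
  rw [integral_add' (i1.add (i2.const_mul q)) ((i3.add i4).const_mul C),
    integral_add' i1 (i2.const_mul q), integral_const_mul, integral_const_mul,
    integral_add' i3 i4, e2] at hmain
  refine hmain.trans ?_
  have p1 : 0 ≤ n1 ^ (q - 2) * ∫ x, ‖h x‖ ^ 2 := by positivity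
  have p2 : 0 ≤ |∫ ξ, H ξ| := abs_nonneg _
  have hX : (∫ ξ, |ballFourier d ξ| ^ (q - 2) * ‖𝓕 h ξ‖ ^ 2) + (∫ ξ, ‖𝓕 h ξ‖ ^ q)
      ≤ (1 + |∫ ξ, H ξ|) * (n1 ^ 2 + n1 ^ (q - 2) * ∫ x, ‖h x‖ ^ 2) := by
    nlinarith [sq_nonneg n1, mul_nonneg p2 p1]
  have := mul_le_mul_of_nonneg_left hX hC.le
  linarith

end BallExpansion

/-! ### Pointwise estimates for the deviation h from the ball. -/

section Deviation

variable {d : ℕ} {E : Set (EuclideanSpace ℝ (Fin d))} {f g : EuclideanSpace ℝ (Fin d) → ℝ}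

theorem norm_modulatedIndicator_le {x : EuclideanSpace ℝ (Fin d)} (hf : 0 ≤ f x ∧ f x ≤ 1) :
    ‖modulatedIndicator E f g x‖ ≤ E.indicator (fun _ => (1 : ℝ)) x := by
  by_cases hx : x ∈ E
  · rw [modulatedIndicator, Set.indicator_of_mem hx, Set.indicator_of_mem hx, norm_mul,
      Complex.norm_exp_I_mul_ofReal, mul_one, Complex.norm_real, Real.norm_of_nonneg hf.1]
    exact hf.2
  · rw [modulatedIndicator, Set.indicator_of_notMem hx, Set.indicator_of_notMem hx, norm_zero]

theorem norm_modulatedIndicator_sub_ballIndicator_le_two {x : EuclideanSpace ℝ (Fin d)}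
    (hf : 0 ≤ f x ∧ f x ≤ 1) : ‖modulatedIndicator E f g x - ballIndicator d x‖ ≤ 2 := by
  have h1 := (norm_modulatedIndicator_le (E := E) (g := g) hf).trans
    (Set.indicator_le_self' (fun _ _ => zero_le_one) x)
  have h2 : ‖ballIndicator d x‖ ≤ 1 := by
    by_cases hx : x ∈ unitBall d <;> simp [ballIndicator, hx]
  exact (norm_sub_le _ _).trans (by linarith)

theorem norm_modulatedIndicator_sub_ballIndicator_le {x : EuclideanSpace ℝ (Fin d)}
    (hf : 0 ≤ f x ∧ f x ≤ 1) :
    ‖modulatedIndicator E f g x - ballIndicator d x‖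
      ≤ (symmDiff E (unitBall d)).indicator (fun _ => (1 : ℝ)) x
        + E.indicator (fun x => |f x - 1|) x + E.indicator (fun x => |g x|) x := by
  by_cases hx : x ∈ E <;> by_cases hB : x ∈ unitBall d
  · have h0 : x ∉ symmDiff E (unitBall d) := by simp [Set.mem_symmDiff, hx, hB]
    rw [modulatedIndicator, ballIndicator, Set.indicator_of_mem hx, Set.indicator_of_mem hB,
      Set.indicator_of_notMem h0, Set.indicator_of_mem hx, Set.indicator_of_mem hx, zero_add]
    have e : (f x : ℂ) * Complex.exp (Complex.I * (g x : ℂ)) - 1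
        = ((f x - 1 : ℝ) : ℂ) * Complex.exp (Complex.I * (g x : ℂ))
          + (Complex.exp (Complex.I * (g x : ℂ)) - 1) := by push_cast; ring
    rw [e]
    refine (norm_add_le _ _).trans (add_le_add ?_ Real.norm_exp_I_mul_ofReal_sub_one_le)
    rw [norm_mul, Complex.norm_exp_I_mul_ofReal, mul_one, Complex.norm_real, Real.norm_eq_abs]
  · have h0 : x ∈ symmDiff E (unitBall d) := by simp [Set.mem_symmDiff, hx, hB]
    have h1 := norm_modulatedIndicator_le (E := E) (g := g) hf
    rw [Set.indicator_of_mem hx] at h1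
    rw [ballIndicator, Set.indicator_of_notMem hB, sub_zero, Set.indicator_of_mem h0,
      Set.indicator_of_mem hx, Set.indicator_of_mem hx]
    linarith [abs_nonneg (f x - 1), abs_nonneg (g x)]
  · have h0 : x ∈ symmDiff E (unitBall d) := by simp [Set.mem_symmDiff, hx, hB]
    rw [modulatedIndicator, ballIndicator, Set.indicator_of_notMem hx, Set.indicator_of_mem hB,
      Set.indicator_of_mem h0, Set.indicator_of_notMem hx, Set.indicator_of_notMem hx]
    simp
  · have h0 : x ∉ symmDiff E (unitBall d) := by simp [Set.mem_symmDiff, hx, hB]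
    rw [modulatedIndicator, ballIndicator, Set.indicator_of_notMem hx, Set.indicator_of_notMem hB,
      Set.indicator_of_notMem h0, Set.indicator_of_notMem hx, Set.indicator_of_notMem hx]
    simp

/-- The bathtub comparison: f - 1_𝔹 is nonpositive on the ball, where K ≥ κ, and nonnegative on E \
𝔹, where K ≤ κ, so K may be replaced by κ. The phase costs K f (1 - cos g), which is quadratic in g.
-/
theorem kernel_mul_re_modulatedIndicator_sub_le {K : EuclideanSpace ℝ (Fin d) → ℝ} {κ A : ℝ}
    (hKA : ∀ x, |K x| ≤ A) (hKin : ∀ x ∈ unitBall d, κ ≤ K x) (hKout : ∀ x ∉ unitBall d, K x ≤ κ)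
    {x : EuclideanSpace ℝ (Fin d)} (hf : 0 ≤ f x ∧ f x ≤ 1) :
    K x * (modulatedIndicator E f g x - ballIndicator d x).re
      ≤ κ * (E.indicator (fun _ => (1 : ℝ)) x - (unitBall d).indicator (fun _ => (1 : ℝ)) x)
        - κ * E.indicator (fun x => |f x - 1|) x + A / 2 * E.indicator (fun x => g x ^ 2) x := by
  have hre : ((f x : ℂ) * Complex.exp (Complex.I * (g x : ℂ))).re = f x * Real.cos (g x) := by
    rw [mul_comm Complex.I, Complex.re_ofReal_mul, Complex.exp_ofReal_mul_I_re]
  have habs : |f x - 1| = 1 - f x := by rw [abs_of_nonpos (by linarith [hf.2])]; ring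
  have hcos : f x * (1 - Real.cos (g x)) ≤ g x ^ 2 / 2 := by
    have h1 := Real.one_sub_sq_div_two_le_cos (x := g x)
    have h2 := Real.cos_le_one (g x)
    nlinarith [hf.1, hf.2]
  have hcos0 : 0 ≤ f x * (1 - Real.cos (g x)) :=
    mul_nonneg hf.1 (by linarith [Real.cos_le_one (g x)])
  have hA : -(K x * (f x * (1 - Real.cos (g x)))) ≤ A / 2 * g x ^ 2 := by
    have h1 := (abs_le.1 (hKA x)).1
    have hA0 : 0 ≤ A := (abs_nonneg _).trans (hKA x)
    nlinarith
  by_cases hx : x ∈ E <;> by_cases hB : x ∈ unitBall d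
  · have hK := hKin x hB
    simp only [modulatedIndicator, ballIndicator, Set.indicator_of_mem hx, Set.indicator_of_mem hB,
      Complex.sub_re, hre, habs, Complex.one_re]
    nlinarith [hf.2]
  · have hK := hKout x hB
    simp only [modulatedIndicator, ballIndicator, Set.indicator_of_mem hx,
      Set.indicator_of_notMem hB, Complex.sub_re, hre, habs, Complex.zero_re]
    nlinarith [hf.1]
  · have hK := hKin x hB
    simp only [modulatedIndicator, ballIndicator, Set.indicator_of_notMem hx,
      Set.indicator_of_mem hB, Complex.sub_re, Complex.one_re, Complex.zero_re]
    linarith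
  · simp only [modulatedIndicator, ballIndicator, Set.indicator_of_notMem hx,
      Set.indicator_of_notMem hB, Complex.sub_re, Complex.zero_re]
    simp

theorem aestronglyMeasurable_modulatedIndicator (hE : NullMeasurableSet E volume)
    (hf : AEMeasurable f volume) (hg : AEMeasurable g volume) :
    AEStronglyMeasurable (modulatedIndicator E f g) volume := by
  refine AEStronglyMeasurable.indicator₀ (AEMeasurable.aestronglyMeasurable ?_) hE
  exact (Complex.measurable_ofReal.comp_aemeasurable hf).mul
    (Complex.measurable_exp.comp_aemeasurable
      ((Complex.measurable_ofReal.comp_aemeasurable hg).const_mul _))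

theorem memLp_modulatedIndicator (hE : NullMeasurableSet E volume) (hEfin : volume E ≠ ∞)
    (hf : AEMeasurable f volume)
    (hf01 : ∀ᵐ x ∂(volume : Measure (EuclideanSpace ℝ (Fin d))), 0 ≤ f x ∧ f x ≤ 1)
    (hg : AEMeasurable g volume) (p : ℝ≥0∞) : MemLp (modulatedIndicator E f g) p volume := by
  have h1 : MemLp ((toMeasurable volume E).indicator fun _ => (1 : ℝ)) p volume :=
    memLp_indicator_const p (measurableSet_toMeasurable _ _) 1
      (Or.inr (by rwa [measure_toMeasurable]))
  refine h1.mono (aestronglyMeasurable_modulatedIndicator hE hf hg) ?_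
  filter_upwards [hf01] with x hx
  refine (norm_modulatedIndicator_le hx).trans ((Set.indicator_le_indicator_of_subset
    (subset_toMeasurable volume E) (fun _ => zero_le_one) x).trans (le_abs_self _))

theorem lpNormOn_one_eq {S : Set (EuclideanSpace ℝ (Fin d))} {h : EuclideanSpace ℝ (Fin d) → ℝ}
    (hh : AEMeasurable h volume) : lpNormOn 1 S h = ∫ x in S, |h x| := by
  rw [lpNormOn, eLpNorm_one_eq_lintegral_enorm,
    ← integral_norm_eq_lintegral_enorm hh.aestronglyMeasurable.restrict]
  rfl

theorem lpNormOn_two_sq {S : Set (EuclideanSpace ℝ (Fin d))} {h : EuclideanSpace ℝ (Fin d) → ℝ}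
    (hh : MemLp h 2 (volume.restrict S)) : lpNormOn 2 S h ^ 2 = ∫ x in S, h x ^ 2 := by
  have h0 : 0 ≤ ∫ x in S, ‖h x‖ ^ 2 := by positivity
  rw [lpNormOn, hh.eLpNorm_eq_integral_rpow_norm (by norm_num) (by norm_num)]
  simp only [ENNReal.toReal_ofNat, Real.rpow_two]
  rw [ENNReal.toReal_ofReal (by positivity), ← Real.rpow_natCast, ← Real.rpow_mul h0]
  norm_num

theorem integral_abs_le_lpNormOn_two {S : Set (EuclideanSpace ℝ (Fin d))}
    (hS : volume S ≤ volume (unitBall d)) {h : EuclideanSpace ℝ (Fin d) → ℝ}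
    (hh : MemLp h 2 (volume.restrict S)) :
    ∫ x in S, |h x| ≤ (1 + volume.real (unitBall d)) * lpNormOn 2 S h := by
  have hSfin : volume S < ∞ := hS.trans_lt volume_unitBall_lt_top
  -- Hölder's inequality gives the factor |S|^{1/2}, which is at most 1 + |𝔹|.
  have h1 := eLpNorm_le_eLpNorm_mul_rpow_measure_univ (p := 1) (q := 2) (by norm_num) hh.1
  rw [Measure.restrict_apply_univ, eLpNorm_one_eq_lintegral_enorm] at h1
  have h2 := ENNReal.toReal_mono (ENNReal.mul_ne_top hh.2.ne
    (ENNReal.rpow_ne_top_of_nonneg (by norm_num) hSfin.ne)) h1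
  rw [← integral_norm_eq_lintegral_enorm hh.1, ENNReal.toReal_mul, ← ENNReal.toReal_rpow] at h2
  refine h2.trans ?_
  rw [mul_comm]
  refine mul_le_mul_of_nonneg_right ?_ ENNReal.toReal_nonneg
  have h3 : (volume S).toReal ≤ volume.real (unitBall d) :=
    ENNReal.toReal_mono volume_unitBall_lt_top.ne hS
  have h4 : 0 ≤ (volume S).toReal := ENNReal.toReal_nonneg
  norm_num
  rw [← Real.sqrt_eq_rpow, Real.sqrt_le_left (by linarith)]
  nlinarith

end Deviation

/-! ### Integrated estimates for the deviation. -/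

section Deviation

variable {d : ℕ} {E : Set (EuclideanSpace ℝ (Fin d))} {f g : EuclideanSpace ℝ (Fin d) → ℝ}

theorem integral_indicator_one_eq_measureReal {S : Set (EuclideanSpace ℝ (Fin d))}
    (hS : NullMeasurableSet S volume) :
    ∫ x, S.indicator (fun _ => (1 : ℝ)) x = volume.real S := by
  rw [integral_indicator₀ hS, setIntegral_const, smul_eq_mul, mul_one]

theorem integrable_indicator_one {S : Set (EuclideanSpace ℝ (Fin d))}
    (hS : NullMeasurableSet S volume) (hSfin : volume S ≠ ∞) :
    Integrable (S.indicator fun _ => (1 : ℝ)) :=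
  (integrableOn_const hSfin).integrable_indicator₀ hS

theorem nullMeasurableSet_symmDiff (hE : NullMeasurableSet E volume) :
    NullMeasurableSet (symmDiff E (unitBall d)) volume :=
  (hE.diff measurableSet_unitBall.nullMeasurableSet).union
    (measurableSet_unitBall.nullMeasurableSet.diff hE)

theorem volume_symmDiff_ne_top (hEfin : volume E ≠ ∞) : volume (symmDiff E (unitBall d)) ≠ ∞ :=
  ((measure_mono (symmDiff_le_sup (a := E) (b := unitBall d))).trans_lt
    ((measure_union_le _ _).trans_lt
      (ENNReal.add_lt_top.2 ⟨hEfin.lt_top, volume_unitBall_lt_top⟩))).ne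

theorem integrableOn_abs_sub_one {S : Set (EuclideanSpace ℝ (Fin d))} (hS : volume S ≠ ∞)
    (hf : AEMeasurable f volume)
    (hf01 : ∀ᵐ x ∂(volume : Measure (EuclideanSpace ℝ (Fin d))), 0 ≤ f x ∧ f x ≤ 1) :
    IntegrableOn (fun x => |f x - 1|) S := by
  refine Integrable.mono' (integrableOn_const (C := (1 : ℝ)) hS)
    (hf.sub_const 1).abs.aestronglyMeasurable.restrict (ae_restrict_of_ae ?_)
  filter_upwards [hf01] with x hx
  rw [Real.norm_eq_abs, abs_abs, abs_le]
  constructor <;> linarith [hx.1, hx.2]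

theorem integral_norm_deviation_le (hE : NullMeasurableSet E volume)
    (hEB : volume E ≤ volume (unitBall d)) (hf : AEMeasurable f volume)
    (hf01 : ∀ᵐ x ∂(volume : Measure (EuclideanSpace ℝ (Fin d))), 0 ≤ f x ∧ f x ≤ 1)
    (hg2 : MemLp g 2 (volume.restrict E)) :
    ∫ x, ‖(modulatedIndicator E f g - ballIndicator d) x‖
      ≤ volume.real (symmDiff E (unitBall d)) + lpNormOn 1 E (fun x => f x - 1)
        + (1 + volume.real (unitBall d)) * lpNormOn 2 E g := by
  have hEfin : volume E ≠ ∞ := (hEB.trans_lt volume_unitBall_lt_top).ne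
  have hfinm : IsFiniteMeasure (volume.restrict E) := ⟨by
    rw [Measure.restrict_apply_univ]; exact hEfin.lt_top⟩
  have i1 := integrable_indicator_one (nullMeasurableSet_symmDiff hE) (volume_symmDiff_ne_top hEfin)
  have i2 := (integrableOn_abs_sub_one hEfin hf hf01).integrable_indicator₀ hE
  have i3' : IntegrableOn (fun x => |g x|) E := (hg2.integrable (by norm_num)).abs
  have i3 := i3'.integrable_indicator₀ hE
  have h1 := integral_mono_of_nonneg (ae_of_all volume fun x =>
      norm_nonneg ((modulatedIndicator E f g - ballIndicator d) x)) ((i1.add i2).add i3) (by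
    filter_upwards [hf01] with x hx
    exact norm_modulatedIndicator_sub_ballIndicator_le hx)
  rw [integral_add' (i1.add i2) i3, integral_add' i1 i2,
    integral_indicator_one_eq_measureReal (nullMeasurableSet_symmDiff hE),
    integral_indicator₀ hE, integral_indicator₀ hE, ← lpNormOn_one_eq (hf.sub_const 1)] at h1
  linarith [integral_abs_le_lpNormOn_two hEB hg2]

/-- Integrating the bathtub comparison leaves κ(|E| - |𝔹|), which is nonpositive because κ ≥ 0 and
|E| ≤ |𝔹|. -/
theorem integral_kernel_mul_re_deviation_le (hE : NullMeasurableSet E volume)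
    (hEB : volume E ≤ volume (unitBall d)) (hf : AEMeasurable f volume)
    (hf01 : ∀ᵐ x ∂(volume : Measure (EuclideanSpace ℝ (Fin d))), 0 ≤ f x ∧ f x ≤ 1)
    (hg : AEMeasurable g volume) (hg2 : MemLp g 2 (volume.restrict E))
    {K : EuclideanSpace ℝ (Fin d) → ℝ} {κ A : ℝ} (hKc : Continuous K) (hκ : 0 ≤ κ)
    (hKA : ∀ x, |K x| ≤ A) (hKin : ∀ x ∈ unitBall d, κ ≤ K x)
    (hKout : ∀ x ∉ unitBall d, K x ≤ κ) :
    ∫ x, K x * ((modulatedIndicator E f g - ballIndicator d) x).re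
      ≤ -(κ * lpNormOn 1 E (fun x => f x - 1)) + A / 2 * lpNormOn 2 E g ^ 2 := by
  have hEfin : volume E ≠ ∞ := (hEB.trans_lt volume_unitBall_lt_top).ne
  have hBn := (measurableSet_unitBall (d := d)).nullMeasurableSet (μ := volume)
  have i1 := integrable_indicator_one hE hEfin
  have i2 := integrable_indicator_one hBn volume_unitBall_lt_top.ne
  have i3 := (integrableOn_abs_sub_one hEfin hf hf01).integrable_indicator₀ hE
  have i4' : IntegrableOn (fun x => g x ^ 2) E := hg2.integrable_sq
  have i4 := i4'.integrable_indicator₀ hE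
  have hh : Integrable (modulatedIndicator E f g - ballIndicator d) :=
    (memLp_one_iff_integrable.1 (memLp_modulatedIndicator hE hEfin hf hf01 hg 1)).sub
      integrable_ballIndicator
  have i0 : Integrable fun x => K x * ((modulatedIndicator E f g - ballIndicator d) x).re :=
    hh.re.bdd_mul hKc.aestronglyMeasurable (ae_of_all _ fun x => hKA x)
  have h1 := integral_mono_ae i0 ((((i1.sub i2).const_mul κ).sub (i3.const_mul κ)).add
      (i4.const_mul (A / 2))) (by
    filter_upwards [hf01] with x hx
    exact kernel_mul_re_modulatedIndicator_sub_le hKA hKin hKout hx)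
  rw [integral_add' (((i1.sub i2).const_mul κ).sub (i3.const_mul κ)) (i4.const_mul (A / 2)),
    integral_sub' ((i1.sub i2).const_mul κ) (i3.const_mul κ), integral_const_mul,
    integral_const_mul, integral_const_mul, integral_sub' i1 i2,
    integral_indicator_one_eq_measureReal hE, integral_indicator_one_eq_measureReal hBn,
    integral_indicator₀ hE, integral_indicator₀ hE, ← lpNormOn_one_eq (hf.sub_const 1),
    ← lpNormOn_two_sq hg2] at h1
  have h2 : volume.real E ≤ volume.real (unitBall d) :=
    ENNReal.toReal_mono volume_unitBall_lt_top.ne hEB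
  nlinarith

/-- Smallness of f - 1 is assumed on the ball but needed on E; on E \ 𝔹 the bound |f - 1| ≤ 1
suffices. -/
theorem lpNormOn_one_sub_one_le (hE : NullMeasurableSet E volume)
    (hEB : volume E ≤ volume (unitBall d)) (hf : AEMeasurable f volume)
    (hf01 : ∀ᵐ x ∂(volume : Measure (EuclideanSpace ℝ (Fin d))), 0 ≤ f x ∧ f x ≤ 1) :
    lpNormOn 1 E (fun x => f x - 1) ≤ lpNormOn 1 (unitBall d) (fun x => f x - 1)
      + volume.real (symmDiff E (unitBall d)) := by
  have hEfin : volume E ≠ ∞ := (hEB.trans_lt volume_unitBall_lt_top).ne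
  have hBn := (measurableSet_unitBall (d := d)).nullMeasurableSet (μ := volume)
  have i1 := integrable_indicator_one (nullMeasurableSet_symmDiff hE) (volume_symmDiff_ne_top hEfin)
  have i2 := (integrableOn_abs_sub_one hEfin hf hf01).integrable_indicator₀ hE
  have i3 := (integrableOn_abs_sub_one volume_unitBall_lt_top.ne hf hf01).integrable_indicator₀ hBn
  have h1 := integral_mono_ae i2 (i3.add i1) (by
    filter_upwards [hf01] with x hx
    have habs : |f x - 1| ≤ 1 := by rw [abs_le]; constructor <;> linarith [hx.1, hx.2]
    have habs0 := abs_nonneg (f x - 1)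
    rw [Pi.add_apply]
    by_cases hxE : x ∈ E <;> by_cases hB : x ∈ unitBall d <;>
      simp [Set.indicator, Set.mem_symmDiff, hxE, hB, habs]
    linarith)
  rwa [integral_add' i3 i1, integral_indicator_one_eq_measureReal (nullMeasurableSet_symmDiff hE),
    integral_indicator₀ hE, integral_indicator₀ hBn, ← lpNormOn_one_eq (hf.sub_const 1),
    ← lpNormOn_one_eq (hf.sub_const 1)] at h1

end Deviation

/-! ### Absorption of the error terms and conclusion. -/

/-- Here ε = ‖f-1‖_{L¹(E)}, s = √ε, γ = ‖g‖_{L²(E)}, D = |E Δ 𝔹|, n = ‖h‖₁, m = ‖h‖₂² and k is the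
first variation divided by q. Since D and γ are at most s/N and ε ≤ sτ/2, one gets n ≤ τs, so the
remainder is at most κ₀ε/2. The g term costs κ₀ε/4, so k ≤ -(3/4)κ₀ε, and q ≥ 7/2 leaves more than
κ₀ε to spare. -/
theorem first_order_dominates {κ₀ A C v τ N q κ ε γ D n m k s : ℝ} (hκ₀ : 0 < κ₀)
    (hC : 0 ≤ C) (hv0 : 0 ≤ v) (hτ0 : 0 < τ) (hτ1 : τ ≤ 1) (hτC : C * τ ≤ κ₀ / 6) (hN1 : 1 ≤ N)
    (hNA : 2 * A ≤ κ₀ * N) (hNτ : 2 * (2 + v) ≤ τ * N) (hq72 : 7 / 2 ≤ q) (hκ : κ₀ ≤ κ)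
    (hε0 : 0 ≤ ε) (hγ0 : 0 ≤ γ) (hn0 : 0 ≤ n) (hm0 : 0 ≤ m) (hs1 : 0 ≤ s) (hss : s ^ 2 = ε)
    (hετ : ε ≤ τ ^ 2 / 4) (hD : N * D ≤ s) (hγ : N * γ ≤ s) (hnorm : n ≤ D + ε + (1 + v) * γ)
    (hsq : m ≤ 2 * n) (hfirst : k ≤ -(κ * ε) + A / 2 * γ ^ 2) :
    q * k + C * (n ^ 2 + n ^ (q - 2) * m) ≤ -(κ₀ * ε) := by
  have hN0 : 0 < N := by linarith
  have hsτ : s ≤ τ / 2 := by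
    refine abs_le_of_sq_le_sq' (b := τ / 2) ?_ (by positivity) |>.2
    nlinarith
  have hnτ : n ≤ s * τ := by
    have hε : ε ≤ s * (τ / 2) := by
      rw [← hss, sq]; gcongr
    have h1 : N * n ≤ N * (s * τ) := by
      calc N * n ≤ N * (D + ε + (1 + v) * γ) := by gcongr
        _ = N * D + (1 + v) * (N * γ) + N * ε := by ring
        _ ≤ s + (1 + v) * s + N * (s * (τ / 2)) := by gcongr
        _ = s * (2 * (2 + v)) / 2 + N * (s * τ) / 2 := by ring
        _ ≤ s * (τ * N) / 2 + N * (s * τ) / 2 := by gcongr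
        _ = N * (s * τ) := by ring
    exact le_of_mul_le_mul_left h1 hN0
  have hn1 : n ≤ 1 := by nlinarith
  have hn2 : n ^ 2 ≤ ε * τ := by
    calc n ^ 2 ≤ (s * τ) ^ 2 := by gcongr
      _ = ε * τ ^ 2 := by rw [mul_pow, hss]
      _ ≤ ε * τ := by gcongr; nlinarith
  have hpow : n ^ (q - 2) * m ≤ 2 * n ^ 2 := by
    have h1 : n ^ (q - 2) ≤ n := by
      simpa using Real.rpow_le_rpow_of_exponent_ge' hn0 hn1 zero_le_one (by linarith : 1 ≤ q - 2)
    calc n ^ (q - 2) * m ≤ n * (2 * n) := by gcongr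
      _ = 2 * n ^ 2 := by ring
  have hCn : C * (n ^ 2 + n ^ (q - 2) * m) ≤ κ₀ / 2 * ε := by
    calc C * (n ^ 2 + n ^ (q - 2) * m) ≤ C * (3 * (ε * τ)) := by gcongr; linarith
      _ = 3 * ε * (C * τ) := by ring
      _ ≤ 3 * ε * (κ₀ / 6) := by gcongr
      _ = _ := by ring
  have hγ2 : A / 2 * γ ^ 2 ≤ κ₀ / 4 * ε := by
    have h1 : (N * γ) ^ 2 ≤ ε := by rw [← hss]; gcongr
    have h2 : N * γ ^ 2 ≤ ε := by nlinarith [mul_nonneg hN0.le (sq_nonneg γ)]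
    nlinarith [mul_le_mul_of_nonneg_right hNA (sq_nonneg γ)]
  have hκε : κ₀ * ε ≤ κ * ε := by gcongr
  have hk : k ≤ -(3 / 4 * κ₀ * ε) := by linarith
  have hqk : q * k ≤ q * -(3 / 4 * κ₀ * ε) := by gcongr
  have hκε0 : 0 ≤ κ₀ * ε := by positivity
  nlinarith

theorem mainTheorem8 (d : ℕ) (hd : 1 ≤ d) (qbar : ℕ) (hqbar_even : Even qbar)
    (hqbar : 4 ≤ qbar) :
    ∃ M N δ₀ ρ : ℝ, 0 < M ∧ 0 < N ∧ 0 < δ₀ ∧ 0 < ρ ∧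
      ∀ q : ℝ, 3 < q → |q - (qbar : ℝ)| ≤ ρ →
        ∃ c : ℝ, 0 < c ∧
          ∀ (E : Set (EuclideanSpace ℝ (Fin d))) (f g : EuclideanSpace ℝ (Fin d) → ℝ),
            NullMeasurableSet E volume →
            volume E ≤ volume (unitBall d) →
            AEMeasurable f volume →
            (∀ᵐ x ∂(volume : Measure (EuclideanSpace ℝ (Fin d))), 0 ≤ f x ∧ f x ≤ 1) →
            AEMeasurable g volume →
            MemLp g 2 (volume.restrict E) →
            lpNormOn 1 (unitBall d) (fun x => f x - 1) ≤ δ₀ →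
            lpNormOn 2 E g ≤ δ₀ →
            volume.real (symmDiff E (unitBall d)) ≤ δ₀ →
            max (M * N * volume.real (symmDiff E (unitBall d))) (N * lpNormOn 2 E g) ≤
              Real.sqrt (lpNormOn 1 E (fun x => f x - 1)) →
            MemLp (𝓕 (modulatedIndicator E f g)) (ENNReal.ofReal q) volume ∧
            MemLp (𝓕 (ballIndicator d)) (ENNReal.ofReal q) volume ∧
            fourierLqPow q (modulatedIndicator E f g) ≤
              fourierLqPow q (ballIndicator d) - c * lpNormOn 1 E (fun x => f x - 1) := by
  have h4 : (4 : ℝ) ≤ qbar := by exact_mod_cast hqbar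
  obtain ⟨ρ₁, κ₀, A, hρ₁, hρ₁', hκ₀, hA, hkernel⟩ := exists_kernel_level hd hqbar_even hqbar
  obtain ⟨ρ₂, C, hρ₂, hρ₂', hC, hexp⟩ := exists_fourierLqPow_add_le d (qbar + 1)
  set v := volume.real (unitBall d) with hv
  have hv0 : 0 ≤ v := measureReal_nonneg
  -- τ is the target ratio ‖h‖₁ / √ε. The remainder is at most 3Cτε, hence the 6 in the denominator.
  set τ : ℝ := min 1 (κ₀ / (6 * C)) with hτ
  have hτ0 : 0 < τ := by positivity
  have hτ1 : τ ≤ 1 := min_le_left _ _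
  have hτC : C * τ ≤ κ₀ / 6 := by
    have : τ ≤ κ₀ / (6 * C) := min_le_right _ _
    rw [le_div_iff₀ (by positivity)] at this
    linarith
  -- The second summand of N absorbs the g term of the first variation; the third makes the
  -- contributions of D and g to ‖h‖₁ at most half of τ√ε.
  set N : ℝ := 1 + 2 * A / κ₀ + 2 * (2 + v) / τ with hN
  have hN1 : 1 ≤ N := by
    have h1 : 0 ≤ 2 * A / κ₀ := by positivity
    have h2 : 0 ≤ 2 * (2 + v) / τ := by positivity
    linarith
  have hN0 : 0 < N := by linarith
  have hNA : 2 * A ≤ κ₀ * N := by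
    have h2 : 0 ≤ 2 * (2 + v) / τ := by positivity
    have : 2 * A / κ₀ ≤ N := by linarith
    rw [div_le_iff₀ hκ₀] at this
    linarith
  have hNτ : 2 * (2 + v) ≤ τ * N := by
    have h1 : 0 ≤ 2 * A / κ₀ := by positivity
    have : 2 * (2 + v) / τ ≤ N := by linarith
    rw [div_le_iff₀ hτ0] at this
    linarith
  -- Both ‖f-1‖_{L¹(𝔹)} and |E Δ 𝔹| are at most δ₀, so ε ≤ 2δ₀ = τ²/4, that is √ε ≤ τ/2. As N
  -- already carries the smallness, M = 1 is enough.
  refine ⟨1, N, τ ^ 2 / 8, min ρ₁ ρ₂, one_pos, hN0, by positivity, by positivity, ?_⟩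
  intro q hq3 hq
  obtain ⟨K, κ, hκ, hK, hKA, hKin, hKout⟩ := hkernel q (hq.trans (min_le_left _ _))
  have hqb := abs_le.1 (hq.trans (min_le_right _ _))
  have hq72 : 7 / 2 ≤ q := by linarith [hqb.1]
  have hKc : Continuous K := by
    have h1 := Complex.continuous_re.comp (continuous_fourier (integrable_powerSymbol (d := d) hq72))
    have h2 : Complex.re ∘ 𝓕 (fun ξ => (powerSymbol d q ξ : ℂ)) = K := by
      ext x
      rw [Function.comp_apply, hK, Complex.ofReal_re]
    rwa [h2] at h1
  -- The constant is the lower bound for the levels κ, uniform over the admissible q.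
  refine ⟨κ₀, hκ₀, ?_⟩
  intro E f g hE hEB hf hf01 hg hg2 hfB hgE hEδ hmax
  have hEfin : volume E ≠ ∞ := (hEB.trans_lt volume_unitBall_lt_top).ne
  have hF1 := memLp_one_iff_integrable.1 (memLp_modulatedIndicator hE hEfin hf hf01 hg 1)
  have hF2 := memLp_modulatedIndicator hE hEfin hf hf01 hg 2
  have hB1 := integrable_ballIndicator (d := d)
  have hB2 := memLp_ballIndicator (d := d) 2
  refine ⟨memLp_fourier_rpow hF1 hF2 (by linarith), memLp_fourier_rpow hB1 hB2 (by linarith), ?_⟩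
  set h := modulatedIndicator E f g - ballIndicator d with hh
  have hFh : modulatedIndicator E f g = ballIndicator d + h := by rw [hh]; abel
  have hmain := hexp q (by linarith [hqb.1]) (by linarith [hqb.2]) K hK h (hF1.sub hB1)
    (hF2.sub hB2)
  rw [← hFh] at hmain
  have hfirst := integral_kernel_mul_re_deviation_le hE hEB hf hf01 hg hg2 hKc (hκ₀.le.trans hκ)
    hKA hKin hKout
  have hnorm := integral_norm_deviation_le hE hEB hf hf01 hg2
  have hεδ := lpNormOn_one_sub_one_le hE hEB hf hf01
  rw [← hh] at hfirst hnorm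
  have hsq : ∫ x, ‖h x‖ ^ 2 ≤ 2 * ∫ x, ‖h x‖ := by
    rw [← integral_const_mul]
    refine integral_mono_of_nonneg (ae_of_all _ fun x => by positivity)
      ((hF1.sub hB1).norm.const_mul 2) ?_
    filter_upwards [hf01] with x hx
    have h1 : ‖h x‖ ≤ 2 := norm_modulatedIndicator_sub_ballIndicator_le_two hx
    nlinarith [norm_nonneg (h x)]
  have hn0 : 0 ≤ ∫ x, ‖h x‖ := by positivity
  have hs0 : 0 ≤ ∫ x, ‖h x‖ ^ 2 := by positivity
  have hε0 : 0 ≤ lpNormOn 1 E (fun x => f x - 1) := ENNReal.toReal_nonneg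
  have hγ0 : 0 ≤ lpNormOn 2 E g := ENNReal.toReal_nonneg
  have hD := (le_max_left _ _).trans hmax
  have hγ := (le_max_right _ _).trans hmax
  have hss := Real.sq_sqrt hε0
  have hs1 := Real.sqrt_nonneg (lpNormOn 1 E (fun x => f x - 1))
  generalize lpNormOn 1 E (fun x => f x - 1) = ε at *
  generalize lpNormOn 2 E g = γ at *
  generalize volume.real (symmDiff E (unitBall d)) = D at *
  generalize ∫ x, ‖h x‖ = n at *
  generalize ∫ x, ‖h x‖ ^ 2 = m at *
  generalize ∫ x, K x * (h x).re = k at *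
  generalize √ε = s at *
  have hfin := first_order_dominates hκ₀ hC.le hv0 hτ0 hτ1 hτC hN1 hNA hNτ hq72 hκ hε0 hγ0 hn0
    hs0 hs1 hss (by linarith) (by linarith) hγ hnorm hsq hfirst
  linarith
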